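/- **Setting.** For a real skew-symmetric matrix $\Theta$ of size $d$, let $A_\Theta$ be the noncommutative torus, i.e. the $C^*$-algebra generated by unitaries $U_1,\dots,U_d$ with $U_kU_j=e^{2\pi i\Theta_{jk}}U_jU_k$ (realized as the twisted group $C^*$-algebra of $\mathbb Z^d$ in its faithful left regular representation on $\ell^2(\mathbb Z^d)$), with canonical trace $\tau_\Theta$. On $M_r(A_\Theta)$ use the normalized trace $\tfrac1r\mathrm{Tr}\otimes\tau_\Theta$; its smooth subalgebra $M_r(A_\Theta)^\infty$ consists of the matrices whose entries have rapidly decreasing Fourier coefficients, with its usual Fréchet topology. $\Theta$ is nondegenerate if $e^{2\pi i\langle x,\Theta y\rangle}=1$ for all $y\in\mathbb Z^d$ implies $x=0$. A toric map $\varphi_{M,z}\colon A_\Theta\to A_{\Psi}$ is a unital $*$-homomorphism with $U_j\mapsto z_jV^{Me_j}$, where $M$ is an integer matrix, $|z_j|=1$, and $V^x=V_1^{x_1}\cdots V_{d'}^{x_{d'}}$ in the generators of $A_\Psi$. A *protoral system* is a sequence $B_n=M_{r_n}(A_{\Theta_n})$, with $r_n\ge1$ and $\Theta_n$ nondegenerate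 skew-symmetric of size $d_n\ge2$, with nonzero $*$-homomorphisms $\phi_n\colon B_n\to B_{n+1}$. Write $\phi_{n,m}\colon B_n\to B_m$ for the composites, $A_{pro}=\varinjlim(B_n,\phi_n)$ for the $C^*$-inductive limit, $\iota_n\colon B_n\to A_{pro}$ for the canonical maps, $e_n=\iota_n(1_{B_n})$, and $\tau_n$ for the normalized trace on $B_n$. A *Morita-compatible Dirac structure* on it consists of, for every $n$: 1. a factorization $\phi_n=\iota_{p_n}\circ\alpha_n\circ\psi_n$, where $\psi_n=\mathrm{Id}_{M_{r_n}}\otimes\varphi_{M_n,z_n}\colon B_n\to C_n=M_{r_n}(A_{\Psi_n})$ is an amplified unital toric map (possibly the identity), $p_n\in B_{n+1}^\infty$ is a full projection, $\alpha_n\colon C_n\to p_nB_{n+1}p_n$ is a $*$-isomorphism that restricts to a Fréchet $*$-isomorphism $C_n^\infty\cong p_nB_{n+1}^\infty p_n$, and $\iota_{p_n}$ is the inclusion of the corner (a pure corner map, or a corner map preceded by a dimension-changing or same-dimensional toric map); 2. finite-dimensional Hilbert spaces $S_n\neq0$, $S_n^C$, $S_{n+1}^{(p_n)}$, with $H_n=L^2(B_n,\tau_n)\otimes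 S_n$, $H_n^C=L^2(C_n,\omega_n)\otimes S_n^C$, $H_{n+1}^{(p_n)}=L^2(p_nB_{n+1}p_n,\tau_{p_n})\otimes S_{n+1}^{(p_n)}$, where $\omega_n$ is the normalized trace on $C_n$ and $\tau_{p_n}=\tau_{n+1}/\tau_{n+1}(p_n)$, and with the representations by left multiplication (on $H_n$ it is denoted $\pi_n$); 3. selfadjoint operators $D_n$, $D_n^C$, $D_{n+1}^{(p_n)}$ on these spaces; 4. isometries $I_{\psi_n}\colon H_n\to H_n^C$, $I_{\alpha_n}\colon H_n^C\to H_{n+1}^{(p_n)}$, $I_{\iota_{p_n}}\colon H_{n+1}^{(p_n)}\to H_{n+1}$ that map domain into domain and intertwine the selfadjoint operators there, that intertwine the left-multiplication representations along $\psi_n,\alpha_n,\iota_{p_n}$, and whose composite $I_n\colon H_n\to H_{n+1}$ satisfies $I_n(\Lambda_n(a)\otimes\xi)=t_n^{-1/2}\Lambda_{n+1}(\phi_n(a))\otimes J_n\xi$ for all $a\in B_n$, $\xi\in S_n$, where $\Lambda_n\colon B_n\to L^2(B_n,\tau_n)$ is the canonical map, $t_n=\tau_{n+1}(\phi_n(1))$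 and $J_n\colon S_n\to S_{n+1}$ is an isometry. Put $H_{pro}=\varinjlim(H_n,I_n)$ with canonical isometries $I_{n,\infty}$ and composites $I_{m,k}\colon H_m\to H_k$, let $D_0$ be the operator with domain $\bigcup_nI_{n,\infty}(\mathrm{dom}\,D_n)$ and $D_0I_{n,\infty}\xi=I_{n,\infty}D_n\xi$, and let $D_{pro}=\overline{D_0}$. For a selfadjoint $D$ and a bounded operator $a$, "$[D,a]$ extends to a bounded operator" means that $a\,\mathrm{dom}(D)\subseteq\mathrm{dom}(D)$ and $Da-aD$ on $\mathrm{dom}(D)$ extends to a bounded operator $\overline{[D,a]}$. A locally compact spectral triple $(\mathcal A,H,D)$ on a $C^*$-algebra $A$ consists of a faithful nondegenerate representation $\pi$ of $A$ on $H$, a selfadjoint operator $D$ on $H$, and a dense $*$-subalgebra $\mathcal A\subseteq A$ such that for every $a\in\mathcal A$, $[D,\pi(a)]$ extends to a bounded operator and $\pi(a)(1+D^2)^{-1/2}$ is compact. **Theorem.** Let a protoral system be equipped with a Morita-compatible Dirac structure. Then $D_{pro}$ is selfadjoint, and there is a (unique) representation $\pi$ of $A_{pro}$ on $H_{pro}$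 with $\pi(\iota_n(b))I_{m,\infty}\eta=I_{k,\infty}\pi_k(\phi_{n,k}(b))I_{m,k}\eta$ for all $n,m\le k$, $b\in B_n$, $\eta\in H_m$; it is faithful and nondegenerate. Moreover: (i) Let $a\in B_n^\infty$ and $a_m=\phi_{n,m}(a)$ for $m\ge n$. Then $[D_{pro},\pi(\iota_n(a))]$ extends to a bounded operator on $H_{pro}$ if and only if every $[D_m,\pi_m(a_m)]$, $m\ge n$, extends to a bounded operator and $\sup_{m\ge n}\|\overline{[D_m,\pi_m(a_m)]}\|<\infty$. In that case $\overline{[D_{pro},\pi(\iota_n(a))]}\,I_{m,\infty}=I_{m,\infty}\,\overline{[D_m,\pi_m(a_m)]}$ for all $m\ge n$. (ii) Let $\mathcal A\subseteq A_{pro}$ be a dense $*$-subalgebra that contains every $e_n$ and such that every $a\in\mathcal A$ satisfies $a=e_nae_n$ for some $n$. Then $\pi(a)(1+D_{pro}^2)^{-1/2}$ is compact for every $a\in\mathcal A$ if and only if $\pi(e_n)(1+D_{pro}^2)^{-1/2}$ is compact for every $n$. (iii) Let $\mathcal A$ be as in (ii). If for every $a\in\mathcal A$ either $[D_{pro},\pi(a)]$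 extends to a bounded operator or $a=\iota_n(b)$ for some $n$ and some $b\in B_n^\infty$ that satisfies the stagewise condition of (i), and if $\pi(e_n)(1+D_{pro}^2)^{-1/2}$ is compact for every $n$, then $(\mathcal A,H_{pro},D_{pro})$, with the representation $\pi$, is a locally compact spectral triple on $A_{pro}$. -/

import Mathlib

noncomputable section

namespace Protorus

open scoped ComplexOrder TensorProduct InnerProductSpace
open Filter Topology

/-! ### Noncommutative tori -/

/-- The Hilbert space `ℓ²(ℤᵐ)`. -/
abbrev L2Z (m : ℕ) : Type := lp (fun _ : Fin m → ℤ => ℂ) 2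

/-- The `2`-cocycle `ω_Θ(x, y) = exp (2πi ∑_{j<k} Θ_{jk} x_k y_j)` on `ℤᵐ`. -/
def cocycle {m : ℕ} (Θ : Matrix (Fin m) (Fin m) ℝ) (x y : Fin m → ℤ) : ℂ :=
  Complex.exp ((2 * Real.pi * ∑ j, ∑ k, if j < k then Θ j k * x k * y j else 0 : ℝ) * Complex.I)

theorem norm_cocycle {m : ℕ} (Θ : Matrix (Fin m) (Fin m) ℝ) (x y : Fin m → ℤ) :
    ‖cocycle Θ x y‖ = 1 :=
  Complex.norm_exp_ofReal_mul_I _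

theorem hasSum_translation {m : ℕ} (Θ : Matrix (Fin m) (Fin m) ℝ) (x : Fin m → ℤ) (f : L2Z m) :
    HasSum (fun y => ‖cocycle Θ x (y - x) * f (y - x)‖ ^ (2 : ENNReal).toReal)
      (‖f‖ ^ (2 : ENNReal).toReal) := by
  have h := lp.hasSum_norm (by norm_num : 0 < (2 : ENNReal).toReal) f
  have h2 := (Equiv.hasSum_iff (Equiv.subRight x)).2 h
  refine h2.congr_fun ?_
  intro y
  simp [norm_cocycle]

/-- The `ω_Θ`-twisted left translation `λ_x` on `ℓ²(ℤᵐ)`, with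
`λ_x δ_y = ω_Θ(x, y) δ_{x+y}` and `λ_x λ_y = ω_Θ(x, y) λ_{x+y}`. -/
def translation {m : ℕ} (Θ : Matrix (Fin m) (Fin m) ℝ) (x : Fin m → ℤ) : L2Z m →ₗᵢ[ℂ] L2Z m where
  toFun f := ⟨fun y => cocycle Θ x (y - x) * f (y - x),
    memℓp_gen (hasSum_translation Θ x f).summable⟩
  map_add' f g := by
    ext y
    exact mul_add _ _ _
  map_smul' c f := by
    ext y
    simp only [lp.coeFn_smul, Pi.smul_apply, smul_eq_mul, RingHom.id_apply]
    ring
  norm_map' f := by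
    have h2 : (0 : ℝ) < (2 : ENNReal).toReal := by norm_num
    have h := lp.hasSum_norm h2 (⟨fun y => cocycle Θ x (y - x) * f (y - x),
      memℓp_gen (hasSum_translation Θ x f).summable⟩ : L2Z m)
    have h' := h.unique (hasSum_translation Θ x f)
    exact (Real.rpow_left_inj (norm_nonneg _) (norm_nonneg _) h2.ne').1 h'

theorem translation_apply {m : ℕ} (Θ : Matrix (Fin m) (Fin m) ℝ) (x : Fin m → ℤ) (f : L2Z m)
    (y : Fin m → ℤ) : translation Θ x f y = cocycle Θ x (y - x) * f (y - x) := rfl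

theorem translation_mul {m : ℕ} (Θ : Matrix (Fin m) (Fin m) ℝ) (x y : Fin m → ℤ) (f : L2Z m) :
    translation Θ x (translation Θ y f) = cocycle Θ x y • translation Θ (x + y) f := by
  ext z
  simp only [translation_apply, lp.coeFn_smul, Pi.smul_apply, smul_eq_mul, ← mul_assoc, cocycle,
    ← Complex.exp_add, ← add_mul, ← Complex.ofReal_add, ← mul_add, ← Finset.sum_add_distrib,
    sub_sub]
  congr 5
  refine Finset.sum_congr rfl fun (j : Fin m) _ => Finset.sum_congr rfl fun (k : Fin m) _ => ?_
  split_ifs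
  · simp only [Pi.sub_apply, Pi.add_apply, Int.cast_sub, Int.cast_add]
    ring
  · simp

/-- The twisted group algebra `C*(ℤᵐ, ω_Θ)`: the norm closed `*`-subalgebra of
`B(ℓ²(ℤᵐ))` generated by the twisted translations. -/
def torusSubalgebra {m : ℕ} (Θ : Matrix (Fin m) (Fin m) ℝ) :
    StarSubalgebra ℂ (L2Z m →L[ℂ] L2Z m) :=
  (StarAlgebra.adjoin ℂ
    (Set.range fun x : Fin m → ℤ => (translation Θ x).toContinuousLinearMap)).topologicalClosure

instance {m : ℕ} (Θ : Matrix (Fin m) (Fin m) ℝ) :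
    IsClosed (torusSubalgebra Θ : Set (L2Z m →L[ℂ] L2Z m)) :=
  StarSubalgebra.isClosed_topologicalClosure _

/-- The noncommutative torus `A_Θ`, realized as the twisted group `C*`-algebra of the amenable
group `ℤᵐ` in its (faithful) left regular representation. -/
def NCTorus {m : ℕ} (Θ : Matrix (Fin m) (Fin m) ℝ) : Type := torusSubalgebra Θ

namespace NCTorus

variable {m : ℕ} {Θ : Matrix (Fin m) (Fin m) ℝ}

instance : CStarAlgebra (NCTorus Θ) := inferInstanceAs (CStarAlgebra (torusSubalgebra Θ))

instance : PartialOrder (NCTorus Θ) := CStarAlgebra.spectralOrder _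

instance : StarOrderedRing (NCTorus Θ) := CStarAlgebra.spectralOrderedRing _

/-- The operator on `ℓ²(ℤᵐ)` given by an element of `A_Θ`. -/
def toCLM : NCTorus Θ →⋆ₐ[ℂ] (L2Z m →L[ℂ] L2Z m) := (torusSubalgebra Θ).subtype

variable (Θ) in
/-- The ordered monomial `U^x = U₁^{x₁} ⋯ U_m^{x_m}`, which is the twisted translation `λ_x`. -/
def monomial (x : Fin m → ℤ) : NCTorus Θ :=
  ⟨(translation Θ x).toContinuousLinearMap,
    StarSubalgebra.le_topologicalClosure _ (StarAlgebra.subset_adjoin ℂ _ ⟨x, rfl⟩)⟩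

variable (Θ) in
/-- The canonical unitary generator `U_j`. -/
def gen (j : Fin m) : NCTorus Θ := monomial Θ (Pi.single j 1)

theorem monomial_mul (x y : Fin m → ℤ) :
    monomial Θ x * monomial Θ y = cocycle Θ x y • monomial Θ (x + y) :=
  Subtype.ext (ContinuousLinearMap.ext fun f => translation_mul Θ x y f)

theorem cocycle_single (j k : Fin m) :
    cocycle Θ (Pi.single k 1) (Pi.single j 1) =
      Complex.exp ((2 * Real.pi * if j < k then Θ j k else 0 : ℝ) * Complex.I) := by
  unfold cocycle
  congr 4
  rw [Finset.sum_eq_single j, Finset.sum_eq_single k] <;> simp +contextual [Pi.single_apply]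

/-- The defining relations `U_k U_j = exp (2πi Θ_{jk}) U_j U_k`. -/
theorem gen_mul_gen (hΘ : Θ.transpose = -Θ) (j k : Fin m) :
    gen Θ k * gen Θ j = Complex.exp ((2 * Real.pi * Θ j k : ℝ) * Complex.I) •
      (gen Θ j * gen Θ k) := by
  have hs : Θ k j = -Θ j k := congrFun (congrFun hΘ j) k
  unfold gen
  rw [monomial_mul, monomial_mul, smul_smul, cocycle_single, cocycle_single, ← Complex.exp_add,
    ← add_mul, ← Complex.ofReal_add, add_comm (Pi.single k 1)]
  congr 4
  rcases lt_trichotomy j k with h | h | h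
  · simp [h, h.not_gt]
  · subst h
    simp [show Θ j j = 0 by linarith]
  · simp [h, h.not_gt, hs]

/-- The Fourier coefficient `a_x = τ_Θ((U^x)^* a) = ⟨δ_x, a δ_0⟩`, so that formally
`a = ∑_x a_x U^x`. -/
def coeff (a : NCTorus Θ) (x : Fin m → ℤ) : ℂ := toCLM a (lp.single 2 0 1) x

/-- The canonical tracial state `τ_Θ(a) = a_0 = ⟨δ_0, a δ_0⟩`. -/
def trace : NCTorus Θ →ₗ[ℂ] ℂ where
  toFun a := coeff a 0
  map_add' a b := by simp [coeff]
  map_smul' c a := by simp [coeff]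

theorem trace_star_mul_self_nonneg (a : NCTorus Θ) : 0 ≤ trace (star a * a) := by
  have h : trace (star a * a) =
      ⟪(lp.single 2 0 1 : L2Z m), toCLM (star a * a) (lp.single 2 0 1)⟫_ℂ := by
    rw [lp.inner_single_left]
    simp [trace, coeff]
  rw [h, map_mul, map_star, ContinuousLinearMap.star_eq_adjoint, mul_apply_eq_comp,
    ContinuousLinearMap.adjoint_inner_right, inner_self_eq_norm_sq_to_K (𝕜 := ℂ)]
  have h2 := Complex.zero_le_real.2 (sq_nonneg ‖toCLM a (lp.single 2 0 1)‖)
  rw [Complex.ofReal_pow] at h2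
  exact h2

end NCTorus

/-- `Θ` is nondegenerate: `exp (2πi ⟨x, Θ y⟩) = 1` for all `y ∈ ℤᵐ` forces `x = 0`. -/
def IsNondegenerate {m : ℕ} (Θ : Matrix (Fin m) (Fin m) ℝ) : Prop :=
  ∀ x : Fin m → ℤ,
    (∀ y : Fin m → ℤ,
      Complex.exp ((2 * Real.pi * ∑ j, ∑ k, (x j : ℝ) * Θ j k * (y k : ℝ) : ℝ) * Complex.I) = 1) →
    x = 0

/-- A unital toric (monomial) map `φ_{M,z} : A_Θ → A_Ψ`, determined by
`U_j ↦ z_j V^{M e_j}` for an integer matrix `M` and phases `z_j`. -/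
def IsToric {m n : ℕ} {Θ : Matrix (Fin m) (Fin m) ℝ} {Ψ : Matrix (Fin n) (Fin n) ℝ}
    (φ : NCTorus Θ →⋆ₐ[ℂ] NCTorus Ψ) : Prop :=
  ∃ (M : Matrix (Fin n) (Fin m) ℤ) (z : Fin m → Circle),
    ∀ j, φ (NCTorus.gen Θ j) = (z j : ℂ) • NCTorus.monomial Ψ (fun i => M i j)

/-! ### Matrix amplifications and their smooth subalgebras -/

/-- The matrix amplification `M_r(A_Θ)`. -/
def MatTorus (r : ℕ) {m : ℕ} (Θ : Matrix (Fin m) (Fin m) ℝ) : Type :=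
  CStarMatrix (Fin r) (Fin r) (NCTorus Θ)

namespace MatTorus

variable {r m : ℕ} {Θ : Matrix (Fin m) (Fin m) ℝ}

instance : CStarAlgebra (MatTorus r Θ) :=
  inferInstanceAs (CStarAlgebra (CStarMatrix (Fin r) (Fin r) (NCTorus Θ)))

instance : PartialOrder (MatTorus r Θ) := CStarAlgebra.spectralOrder _

instance : StarOrderedRing (MatTorus r Θ) := CStarAlgebra.spectralOrderedRing _

/-- The matrix with given entries. -/
def ofEntries (f : Fin r → Fin r → NCTorus Θ) : MatTorus r Θ := CStarMatrix.ofMatrix (Matrix.of f)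

/-- The `(i, j)` entry of a matrix over `A_Θ`. -/
def entry (b : MatTorus r Θ) (i j : Fin r) : NCTorus Θ := CStarMatrix.ofMatrix.symm b i j

/-- The smooth subalgebra `M_r(A_Θ)^∞ = M_r(A_Θ^∞)`: the Fourier coefficients of all entries are
rapidly decreasing on `ℤᵐ`. -/
def IsSmooth (b : MatTorus r Θ) : Prop :=
  ∀ k : ℕ, ∃ C : ℝ, ∀ (i j : Fin r) (x : Fin m → ℤ), (1 + ‖x‖) ^ k * ‖(b.entry i j).coeff x‖ ≤ C

/-- The seminorms `sup_{i,j,x} (1 + |x|)^k |(b_{ij})_x|` that define the Fréchet topology of the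
smooth subalgebra. -/
def smoothSeminorm (k : ℕ) (b : MatTorus r Θ) : ℝ :=
  ⨆ q : Fin r × Fin r × (Fin m → ℤ), (1 + ‖q.2.2‖) ^ k * ‖(b.entry q.1 q.2.1).coeff q.2.2‖

/-- The normalized trace `r⁻¹ Tr ⊗ τ_Θ` on `M_r(A_Θ)`. -/
def trace : MatTorus r Θ →ₚ[ℂ] ℂ :=
  PositiveLinearMap.mk₀
    { toFun := fun b => (r : ℂ)⁻¹ * ∑ i, NCTorus.trace (b.entry i i)
      map_add' := fun a b => by
        have h : ∀ i, (a + b).entry i i = a.entry i i + b.entry i i := fun _ => rfl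
        simp only [h, map_add, Finset.sum_add_distrib, mul_add]
      map_smul' := fun c a => by
        have h : ∀ i, (c • a).entry i i = c • a.entry i i := fun _ => rfl
        simp only [h, map_smul, smul_eq_mul, ← Finset.mul_sum, RingHom.id_apply]
        ring }
    (fun x hx => by
      obtain ⟨s, rfl⟩ := CStarAlgebra.nonneg_iff_eq_star_mul_self.1 hx
      refine mul_nonneg (by simp) (Finset.sum_nonneg fun i _ => ?_)
      have h : (star s * s).entry i i = ∑ k, star (s.entry k i) * s.entry k i := rfl
      rw [h, map_sum]
      exact Finset.sum_nonneg fun k _ => NCTorus.trace_star_mul_self_nonneg _)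

/-- The amplification `Id_{M_r} ⊗ φ : M_r(A_Θ) → M_r(A_Ψ)`, entrywise application of `φ`. -/
def amplify (r : ℕ) {m n : ℕ} {Θ : Matrix (Fin m) (Fin m) ℝ} {Ψ : Matrix (Fin n) (Fin n) ℝ}
    (φ : NCTorus Θ →⋆ₐ[ℂ] NCTorus Ψ) (b : MatTorus r Θ) : MatTorus r Ψ :=
  ofEntries fun i j => φ (b.entry i j)

end MatTorus

/-! ### Corners -/

/-- The corner `pBp` of a `C*`-algebra at a projection `p`, as a `*`-subalgebra. -/
def cornerSubalgebra {B : Type*} [CStarAlgebra B] (p : B) (hp : IsStarProjection p) :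
    NonUnitalStarSubalgebra ℂ B where
  carrier := {x | p * x = x ∧ x * p = x}
  add_mem' := fun ha hb => ⟨by rw [mul_add, ha.1, hb.1], by rw [add_mul, ha.2, hb.2]⟩
  zero_mem' := ⟨mul_zero _, zero_mul _⟩
  mul_mem' := fun ha hb => ⟨by rw [← mul_assoc, ha.1], by rw [mul_assoc, hb.2]⟩
  smul_mem' := fun c x hx => ⟨by rw [mul_smul_comm, hx.1], by rw [smul_mul_assoc, hx.2]⟩
  star_mem' := fun {x} hx =>
    ⟨by simpa [hp.isSelfAdjoint.star_eq] using congrArg star hx.2,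
      by simpa [hp.isSelfAdjoint.star_eq] using congrArg star hx.1⟩

instance {B : Type*} [CStarAlgebra B] (p : B) (hp : IsStarProjection p) :
    IsClosed (cornerSubalgebra p hp : Set B) :=
  (isClosed_eq (by fun_prop) (by fun_prop)).inter (isClosed_eq (by fun_prop) (by fun_prop))

/-- The corner `pBp` as a `C*`-algebra (with unit `p`). -/
def Corner {B : Type*} [CStarAlgebra B] (p : B) (hp : IsStarProjection p) : Type _ :=
  cornerSubalgebra p hp

namespace Corner

variable {B : Type*} [CStarAlgebra B] {p : B} {hp : IsStarProjection p}

instance : NonUnitalCStarAlgebra (Corner p hp) :=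
  inferInstanceAs (NonUnitalCStarAlgebra (cornerSubalgebra p hp))

instance : PartialOrder (Corner p hp) := CStarAlgebra.spectralOrder _

instance : StarOrderedRing (Corner p hp) := CStarAlgebra.spectralOrderedRing _

variable (p hp) in
/-- The corner inclusion `ι_p : pBp → B`. -/
def incl : Corner p hp →⋆ₙₐ[ℂ] B := NonUnitalStarSubalgebraClass.subtype (cornerSubalgebra p hp)

variable (p hp) in
/-- The normalized restriction `τ_p(x) = τ(x) / τ(p)` of a positive functional `τ` to the
corner. -/
def trace [PartialOrder B] [StarOrderedRing B] (τ : B →ₚ[ℂ] ℂ) : Corner p hp →ₚ[ℂ] ℂ :=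
  PositiveLinearMap.mk₀
    { toFun := fun x => τ (incl p hp x) / τ p
      map_add' := fun a b => by simp [add_div]
      map_smul' := fun c a => by simp [mul_div_assoc] }
    (fun x hx => by
      obtain ⟨s, rfl⟩ := CStarAlgebra.nonneg_iff_eq_star_mul_self.1 hx
      refine mul_nonneg ?_ (inv_nonneg.2 (τ.map_nonneg hp.nonneg))
      rw [map_mul, map_star]
      exact τ.map_nonneg (star_mul_self_nonneg _))

end Corner

/-- A projection `p ∈ B` is full: it generates `B` as a closed two-sided ideal. -/
def IsFull {B : Type*} [CStarAlgebra B] (p : B) : Prop :=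
  Dense (Submodule.span ℂ {x : B | ∃ a b, x = a * p * b} : Set B)

/-! ### The Hilbert spaces `L²(A, τ) ⊗ S` -/

theorem norm_sq_sum_tmul {G S : Type*} [NormedAddCommGroup G] [InnerProductSpace ℂ G]
    [NormedAddCommGroup S] [InnerProductSpace ℂ S] [FiniteDimensional ℂ S]
    (v : Fin (Module.finrank ℂ S) → G) :
    ‖∑ i, v i ⊗ₜ[ℂ] (stdOrthonormalBasis ℂ S i)‖ ^ 2 = ∑ i, ‖v i‖ ^ 2 := by
  have h : (⟪∑ i, v i ⊗ₜ[ℂ] (stdOrthonormalBasis ℂ S i),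
      ∑ i, v i ⊗ₜ[ℂ] (stdOrthonormalBasis ℂ S i)⟫_ℂ) = ((∑ i, ‖v i‖ ^ 2 : ℝ) : ℂ) := by
    simp [sum_inner, inner_sum, OrthonormalBasis.inner_eq_ite, inner_self_eq_norm_sq_to_K]
  have h2 := (inner_self_eq_norm_sq_to_K (𝕜 := ℂ)
    (∑ i, v i ⊗ₜ[ℂ] (stdOrthonormalBasis ℂ S i))).symm.trans h
  exact Complex.ofReal_injective (by rw [Complex.ofReal_pow]; exact h2)

theorem norm_rTensor_le {E F S : Type*} [NormedAddCommGroup E] [InnerProductSpace ℂ E]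
    [NormedAddCommGroup F] [InnerProductSpace ℂ F]
    [NormedAddCommGroup S] [InnerProductSpace ℂ S] [FiniteDimensional ℂ S]
    (T : E →L[ℂ] F) (x : E ⊗[ℂ] S) : ‖(T : E →ₗ[ℂ] F).rTensor S x‖ ≤ ‖T‖ * ‖x‖ := by
  obtain ⟨v, rfl⟩ : ∃ v : Fin (Module.finrank ℂ S) → E,
      x = ∑ i, v i ⊗ₜ[ℂ] (stdOrthonormalBasis ℂ S i) := by
    induction x with
    | zero => exact ⟨0, by simp⟩
    | add x y hx hy =>
      obtain ⟨v, rfl⟩ := hx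
      obtain ⟨w, rfl⟩ := hy
      exact ⟨v + w, by simp [TensorProduct.add_tmul, Finset.sum_add_distrib]⟩
    | tmul e s =>
      refine ⟨fun i => (stdOrthonormalBasis ℂ S).repr s i • e, ?_⟩
      conv_lhs => rw [← (stdOrthonormalBasis ℂ S).sum_repr s]
      simp [TensorProduct.tmul_sum, TensorProduct.smul_tmul]
  rw [← sq_le_sq₀ (norm_nonneg _) (by positivity), mul_pow, map_sum]
  simp only [LinearMap.rTensor_tmul, ContinuousLinearMap.coe_coe]
  rw [norm_sq_sum_tmul (fun i => T (v i)), norm_sq_sum_tmul v, Finset.mul_sum]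
  refine Finset.sum_le_sum fun i _ => ?_
  rw [← mul_pow]
  gcongr
  exact T.le_opNorm _

section L2

variable {A : Type*} [NonUnitalCStarAlgebra A] [PartialOrder A] [StarOrderedRing A]

/-- The Hilbert space `L²(A, τ) ⊗ S`, where `L²(A, τ)` is the GNS space. -/
def L2Tensor (τ : A →ₚ[ℂ] ℂ) (S : Type*) [NormedAddCommGroup S] [InnerProductSpace ℂ S] :
    Type _ := UniformSpace.Completion (τ.GNS ⊗[ℂ] S)

namespace L2Tensor

variable (τ : A →ₚ[ℂ] ℂ) {S : Type*} [NormedAddCommGroup S] [InnerProductSpace ℂ S]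

instance : NormedAddCommGroup (L2Tensor τ S) :=
  inferInstanceAs (NormedAddCommGroup (UniformSpace.Completion (τ.GNS ⊗[ℂ] S)))

instance : InnerProductSpace ℂ (L2Tensor τ S) :=
  inferInstanceAs (InnerProductSpace ℂ (UniformSpace.Completion (τ.GNS ⊗[ℂ] S)))

instance : CompleteSpace (L2Tensor τ S) :=
  inferInstanceAs (CompleteSpace (UniformSpace.Completion (τ.GNS ⊗[ℂ] S)))

/-- The canonical isometry from the algebraic tensor product with dense range. -/
def ofTensor : τ.GNS ⊗[ℂ] S →ₗᵢ[ℂ] L2Tensor τ S :=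
  (UniformSpace.Completion.toComplₗᵢ : _ →ₗᵢ[ℂ] UniformSpace.Completion (τ.GNS ⊗[ℂ] S))

/-- The vector `Λ(a) ⊗ ξ`. -/
def vec (a : A) (ξ : S) : L2Tensor τ S :=
  ofTensor τ ((τ.toPreGNS a : τ.GNS) ⊗ₜ[ℂ] ξ)

/-- The representation of `A` on `L²(A, τ) ⊗ S` by left multiplication,
`π(a) (Λ(b) ⊗ ξ) = Λ(ab) ⊗ ξ`. -/
def leftMul [FiniteDimensional ℂ S] (a : A) : L2Tensor τ S →L[ℂ] L2Tensor τ S :=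
  ((((τ.gnsNonUnitalStarAlgHom a : τ.GNS →ₗ[ℂ] τ.GNS).rTensor S).mkContinuous
    ‖τ.gnsNonUnitalStarAlgHom a‖ (norm_rTensor_le _)).completion :
      UniformSpace.Completion (τ.GNS ⊗[ℂ] S) →L[ℂ] UniformSpace.Completion (τ.GNS ⊗[ℂ] S))

theorem leftMul_ofTensor [FiniteDimensional ℂ S] (a : A) (x : τ.GNS ⊗[ℂ] S) :
    leftMul τ a (ofTensor τ x) =
      ofTensor τ ((τ.gnsNonUnitalStarAlgHom a : τ.GNS →ₗ[ℂ] τ.GNS).rTensor S x) :=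
  UniformSpace.Completion.map_coe (ContinuousLinearMap.uniformContinuous _) _

theorem leftMul_vec [FiniteDimensional ℂ S] (a b : A) (ξ : S) :
    leftMul τ a (vec τ b ξ) = vec τ (a * b) ξ := by
  simp [leftMul_ofTensor, vec]

end L2Tensor

end L2

/-! ### Inductive limits of Hilbert spaces along isometries -/

section HilbertLimit

variable {E : ℕ → Type*} [∀ n, NormedAddCommGroup (E n)] [∀ n, InnerProductSpace ℂ (E n)]

/-- The composite `V_{n,k} = V_{k-1} ∘ ⋯ ∘ V_n` for `n ≤ k`. -/
def isometryTo (V : ∀ n, E n →ₗᵢ[ℂ] E (n + 1)) {n k : ℕ} (h : n ≤ k) : E n →ₗᵢ[ℂ] E k :=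
  Nat.leRecOn (C := fun k => E n →ₗᵢ[ℂ] E k) h (fun {k} f => (V k).comp f) LinearIsometry.id

theorem isometryTo_self (V : ∀ n, E n →ₗᵢ[ℂ] E (n + 1)) (n : ℕ) (x : E n) :
    isometryTo V le_rfl x = x := by
  rw [isometryTo, Nat.leRecOn_self]
  rfl

theorem isometryTo_succ (V : ∀ n, E n →ₗᵢ[ℂ] E (n + 1)) {n k : ℕ} (h : n ≤ k) (x : E n) :
    isometryTo V (Nat.le_succ_of_le h) x = V k (isometryTo V h x) := by
  rw [isometryTo, Nat.leRecOn_succ h]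
  rfl

/-- Sequences that are eventually compatible with the isometries: they represent the elements of
the algebraic inductive limit. -/
def preHilbertSubmodule (V : ∀ n, E n →ₗᵢ[ℂ] E (n + 1)) : Submodule ℂ (∀ n, E n) where
  carrier := {f | ∀ᶠ n in atTop, f (n + 1) = V n (f n)}
  add_mem' := fun {f g} hf hg => by
    filter_upwards [hf, hg] with n h1 h2
    simp [h1, h2]
  zero_mem' := Eventually.of_forall fun n => by simp
  smul_mem' := fun c f hf => by
    filter_upwards [hf] with n h1
    simp [h1]

/-- The algebraic inductive limit (before identifying eventually equal sequences). -/
def PreHilbertLimit (V : ∀ n, E n →ₗᵢ[ℂ] E (n + 1)) : Type _ := preHilbertSubmodule V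

namespace PreHilbertLimit

variable {V : ∀ n, E n →ₗᵢ[ℂ] E (n + 1)}

instance : AddCommGroup (PreHilbertLimit V) :=
  inferInstanceAs (AddCommGroup (preHilbertSubmodule V))

instance : Module ℂ (PreHilbertLimit V) := inferInstanceAs (Module ℂ (preHilbertSubmodule V))

/-- The underlying sequence. -/
def seq : PreHilbertLimit V →ₗ[ℂ] (∀ n, E n) := (preHilbertSubmodule V).subtype

/-- The (eventually constant) limit of the inner products. -/
def limInner (f g : PreHilbertLimit V) : ℂ :=
  limUnder atTop fun n => ⟪seq f n, seq g n⟫_ℂ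

theorem eventually_inner (f g : PreHilbertLimit V) :
    ∀ᶠ n in atTop, ⟪seq f n, seq g n⟫_ℂ = limInner f g := by
  obtain ⟨N, hN⟩ := eventually_atTop.1 (f.2.and g.2)
  have h : ∀ n ≥ N, ⟪seq f n, seq g n⟫_ℂ = ⟪seq f N, seq g N⟫_ℂ := by
    intro n hn
    induction n, hn using Nat.le_induction with
    | base => rfl
    | succ n hn ih =>
      obtain ⟨h1, h2⟩ := hN n hn
      have h1' : seq f (n + 1) = V n (seq f n) := h1
      have h2' : seq g (n + 1) = V n (seq g n) := h2
      rw [h1', h2', LinearIsometry.inner_map_map, ih]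
  have h2 : Tendsto (fun n => ⟪seq f n, seq g n⟫_ℂ) atTop (𝓝 ⟪seq f N, seq g N⟫_ℂ) :=
    tendsto_const_nhds.congr' (eventually_atTop.2 ⟨N, fun n hn => (h n hn).symm⟩)
  filter_upwards [eventually_ge_atTop N] with n hn
  rw [h n hn, limInner, h2.limUnder_eq]

/-- The inner product on the algebraic inductive limit. -/
abbrev core : PreInnerProductSpace.Core ℂ (PreHilbertLimit V) where
  inner := limInner
  conj_inner_symm f g := by
    obtain ⟨n, h1, h2⟩ := ((eventually_inner f g).and (eventually_inner g f)).exists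
    rw [← h1, ← h2, inner_conj_symm]
  re_inner_nonneg f := by
    obtain ⟨n, h1⟩ := (eventually_inner f f).exists
    rw [← h1]
    exact inner_self_nonneg
  add_left f g k := by
    obtain ⟨n, h1, h2, h3⟩ := ((eventually_inner (f + g) k).and
      ((eventually_inner f k).and (eventually_inner g k))).exists
    rw [← h1, ← h2, ← h3, map_add, Pi.add_apply, inner_add_left]
  smul_left f g c := by
    obtain ⟨n, h1, h2⟩ := ((eventually_inner (c • f) g).and (eventually_inner f g)).exists
    rw [← h1, ← h2, map_smul, Pi.smul_apply, inner_smul_left]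

instance : SeminormedAddCommGroup (PreHilbertLimit V) :=
  InnerProductSpace.Core.toSeminormedAddCommGroup (c := core)

instance : InnerProductSpace ℂ (PreHilbertLimit V) := InnerProductSpace.ofCore core

theorem inner_def (f g : PreHilbertLimit V) : ⟪f, g⟫_ℂ = limInner f g := rfl

end PreHilbertLimit

/-- The Hilbert space inductive limit `lim (E_n, V_n)`. -/
def HilbertLimit (V : ∀ n, E n →ₗᵢ[ℂ] E (n + 1)) : Type _ :=
  UniformSpace.Completion (PreHilbertLimit V)

variable (V : ∀ n, E n →ₗᵢ[ℂ] E (n + 1))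

instance : NormedAddCommGroup (HilbertLimit V) :=
  inferInstanceAs (NormedAddCommGroup (UniformSpace.Completion (PreHilbertLimit V)))

instance : InnerProductSpace ℂ (HilbertLimit V) :=
  inferInstanceAs (InnerProductSpace ℂ (UniformSpace.Completion (PreHilbertLimit V)))

instance : CompleteSpace (HilbertLimit V) :=
  inferInstanceAs (CompleteSpace (UniformSpace.Completion (PreHilbertLimit V)))

/-- The canonical isometry from the algebraic inductive limit with dense range. -/
def ofPreHilbertLimit : PreHilbertLimit V →ₗᵢ[ℂ] HilbertLimit V :=
  (UniformSpace.Completion.toComplₗᵢ : _ →ₗᵢ[ℂ] UniformSpace.Completion (PreHilbertLimit V))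

/-- The compatible sequence `(0, …, 0, x, V_n x, V_{n,n+2} x, …)` issued from `x ∈ E_n`. -/
def toPreHilbertLimit (n : ℕ) : E n →ₗ[ℂ] PreHilbertLimit V where
  toFun x := ⟨fun k => if h : n ≤ k then isometryTo V h x else 0, by
    filter_upwards [eventually_ge_atTop n] with k hk
    rw [dif_pos hk, dif_pos (Nat.le_succ_of_le hk), isometryTo_succ]⟩
  map_add' x y := Subtype.ext <| funext fun k => by
    change (if h : n ≤ k then isometryTo V h (x + y) else 0) =
      (if h : n ≤ k then isometryTo V h x else 0) + (if h : n ≤ k then isometryTo V h y else 0)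
    split_ifs <;> simp
  map_smul' c x := Subtype.ext <| funext fun k => by
    change (if h : n ≤ k then isometryTo V h (c • x) else 0) =
      c • (if h : n ≤ k then isometryTo V h x else 0)
    split_ifs <;> simp

/-- The canonical isometry `V_{n,∞} : E_n → lim (E_n, V_n)`. -/
def toHilbertLimit (n : ℕ) : E n →ₗᵢ[ℂ] HilbertLimit V :=
  (ofPreHilbertLimit V).comp
    ((toPreHilbertLimit V n).isometryOfInner fun x y => by
      rw [PreHilbertLimit.inner_def]
      obtain ⟨k, h1, h2⟩ := ((PreHilbertLimit.eventually_inner (toPreHilbertLimit V n x)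
        (toPreHilbertLimit V n y)).and (eventually_ge_atTop n)).exists
      rw [← h1]
      have h : ∀ z, PreHilbertLimit.seq (toPreHilbertLimit V n z) k = isometryTo V h2 z :=
        fun z => dif_pos h2
      rw [h, h, LinearIsometry.inner_map_map])

end HilbertLimit

/-! ### Inductive limits of `C*`-algebras -/

section CStarLimit

variable {B : ℕ → Type*} [∀ n, NonUnitalCStarAlgebra (B n)]

/-- The composite `φ_{n,k} = φ_{k-1} ∘ ⋯ ∘ φ_n` for `n ≤ k`. -/
def homTo (φ : ∀ n, B n →⋆ₙₐ[ℂ] B (n + 1)) {n k : ℕ} (h : n ≤ k) : B n →⋆ₙₐ[ℂ] B k :=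
  Nat.leRecOn (C := fun k => B n →⋆ₙₐ[ℂ] B k) h (fun {k} f => (φ k).comp f)
    (NonUnitalStarAlgHom.id ℂ (B n))

theorem homTo_self (φ : ∀ n, B n →⋆ₙₐ[ℂ] B (n + 1)) (n : ℕ) (x : B n) :
    homTo φ le_rfl x = x := by
  rw [homTo, Nat.leRecOn_self]
  rfl

theorem homTo_succ (φ : ∀ n, B n →⋆ₙₐ[ℂ] B (n + 1)) {n k : ℕ} (h : n ≤ k) (x : B n) :
    homTo φ (Nat.le_succ_of_le h) x = φ k (homTo φ h x) := by
  rw [homTo, Nat.leRecOn_succ h]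
  rfl

theorem homTo_trans (φ : ∀ n, B n →⋆ₙₐ[ℂ] B (n + 1)) {n k l : ℕ} (h : n ≤ k) (h' : k ≤ l)
    (x : B n) : homTo φ h' (homTo φ h x) = homTo φ (h.trans h') x := by
  induction l, h' using Nat.le_induction with
  | base => rw [homTo_self]
  | succ l hl ih => rw [homTo_succ φ hl, ih, homTo_succ φ (h.trans hl)]

/-- A sequence `f_n ∈ B_n` is asymptotically compatible with the connecting maps if
`sup_{k ≥ n} ‖f_k - φ_{n,k}(f_n)‖ → 0` as `n → ∞`. -/
def IsAsymptotic (φ : ∀ n, B n →⋆ₙₐ[ℂ] B (n + 1)) (f : ∀ n, B n) : Prop :=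
  ∀ ε > 0, ∃ N, ∀ n ≥ N, ∀ k, ∀ h : n ≤ k, ‖f k - homTo φ h (f n)‖ ≤ ε

variable {φ : ∀ n, B n →⋆ₙₐ[ℂ] B (n + 1)}

theorem norm_homTo_le {n k : ℕ} (h : n ≤ k) (x : B n) : ‖homTo φ h x‖ ≤ ‖x‖ :=
  NonUnitalStarAlgHom.norm_apply_le _ _

theorem IsAsymptotic.bound {f : ∀ n, B n} (hf : IsAsymptotic φ f) :
    ∃ C > 0, ∃ N, ∀ n ≥ N, ‖f n‖ ≤ C := by
  obtain ⟨N, hN⟩ := hf 1 one_pos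
  refine ⟨‖f N‖ + 1, by positivity, N, fun n hn => ?_⟩
  have h1 := hN N le_rfl n hn
  have h2 := norm_homTo_le (φ := φ) hn (f N)
  have h3 := norm_le_norm_add_norm_sub' (f n) (homTo φ hn (f N))
  linarith

theorem IsAsymptotic.tendsto_norm {f : ∀ n, B n} (hf : IsAsymptotic φ f) :
    ∃ l, Tendsto (fun n => ‖f n‖) atTop (𝓝 l) := by
  obtain ⟨C, -, N₀, hC⟩ := hf.bound
  have hb : IsBoundedUnder (· ≤ ·) atTop fun n => ‖f n‖ :=
    ⟨C, eventually_map.2 (eventually_atTop.2 ⟨N₀, hC⟩)⟩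
  have hb' : IsBoundedUnder (· ≥ ·) atTop fun n => ‖f n‖ :=
    ⟨0, eventually_map.2 (Eventually.of_forall fun n => norm_nonneg _)⟩
  refine ⟨_, tendsto_of_le_liminf_of_limsup_le (a := limsup (fun n => ‖f n‖) atTop) ?_ le_rfl
    hb hb'⟩
  refine le_of_forall_pos_le_add fun ε hε => ?_
  obtain ⟨N, hN⟩ := hf ε hε
  rw [← sub_le_iff_le_add]
  refine le_liminf_of_le hb.isCoboundedUnder_ge (eventually_atTop.2 ⟨N, fun n hn => ?_⟩)
  rw [sub_le_iff_le_add]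
  refine limsup_le_of_le hb'.isCoboundedUnder_le (eventually_atTop.2 ⟨n, fun k hk => ?_⟩)
  have h1 := hN n hn k hk
  have h2 := norm_homTo_le (φ := φ) hk (f n)
  have h3 := norm_le_norm_add_norm_sub' (f k) (homTo φ hk (f n))
  linarith

variable (φ) in
/-- The `*`-algebra of asymptotically compatible sequences. -/
def asymptoticSubalgebra : NonUnitalStarSubalgebra ℂ (∀ n, B n) where
  carrier := {f | IsAsymptotic φ f}
  add_mem' := fun {f g} hf hg ε hε => by
    obtain ⟨N, hN⟩ := hf (ε / 2) (half_pos hε)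
    obtain ⟨M, hM⟩ := hg (ε / 2) (half_pos hε)
    refine ⟨max N M, fun n hn k h => ?_⟩
    have h1 := hN n (le_of_max_le_left hn) k h
    have h2 := hM n (le_of_max_le_right hn) k h
    rw [Pi.add_apply, Pi.add_apply, map_add, add_sub_add_comm]
    exact (norm_add_le _ _).trans (by linarith)
  zero_mem' := fun ε hε => ⟨0, fun n _ k h => by simpa using hε.le⟩
  mul_mem' := fun {f g} hf hg ε hε => by
    obtain ⟨C, hC, N₁, h₁⟩ := IsAsymptotic.bound hf
    obtain ⟨D, hD, N₂, h₂⟩ := IsAsymptotic.bound hg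
    obtain ⟨N₃, h₃⟩ := hf (ε / 2 / D) (by positivity)
    obtain ⟨N₄, h₄⟩ := hg (ε / 2 / C) (by positivity)
    refine ⟨max (max N₁ N₂) (max N₃ N₄), fun n hn k h => ?_⟩
    simp only [ge_iff_le, max_le_iff] at hn
    have e : f k * g k - homTo φ h (f n) * homTo φ h (g n) =
        (f k - homTo φ h (f n)) * g k + homTo φ h (f n) * (g k - homTo φ h (g n)) := by
      rw [sub_mul, mul_sub]
      abel
    rw [Pi.mul_apply, Pi.mul_apply, map_mul, e]
    have i1 : ‖(f k - homTo φ h (f n)) * g k‖ ≤ ε / 2 / D * D :=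
      (norm_mul_le _ _).trans (mul_le_mul (h₃ n hn.2.1 k h) (h₂ k (hn.1.2.trans h))
        (norm_nonneg _) (by positivity))
    have i2 : ‖homTo φ h (f n) * (g k - homTo φ h (g n))‖ ≤ C * (ε / 2 / C) :=
      (norm_mul_le _ _).trans (mul_le_mul ((norm_homTo_le h _).trans (h₁ n hn.1.1))
        (h₄ n hn.2.2 k h) (norm_nonneg _) hC.le)
    rw [div_mul_cancel₀ _ hD.ne'] at i1
    rw [mul_div_cancel₀ _ hC.ne'] at i2
    exact (norm_add_le _ _).trans (by linarith)
  smul_mem' := fun c f hf ε hε => by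
    obtain ⟨N, hN⟩ := hf (ε / (‖c‖ + 1)) (by positivity)
    refine ⟨N, fun n hn k h => ?_⟩
    rw [Pi.smul_apply, Pi.smul_apply, map_smul, ← smul_sub, norm_smul]
    have h1 : ‖c‖ * ‖f k - homTo φ h (f n)‖ ≤ (‖c‖ + 1) * (ε / (‖c‖ + 1)) :=
      mul_le_mul (by linarith) (hN n hn k h) (norm_nonneg _) (by positivity)
    rwa [mul_div_cancel₀ _ (by positivity)] at h1
  star_mem' := fun {f} hf ε hε => by
    obtain ⟨N, hN⟩ := hf ε hε
    refine ⟨N, fun n hn k h => ?_⟩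
    rw [Pi.star_apply, Pi.star_apply, map_star, ← star_sub, norm_star]
    exact hN n hn k h

variable (φ) in
/-- Asymptotically compatible sequences with the seminorm `lim_n ‖f_n‖`. -/
def AsymptoticSeq : Type _ := asymptoticSubalgebra φ

namespace AsymptoticSeq

instance : NonUnitalRing (AsymptoticSeq φ) :=
  inferInstanceAs (NonUnitalRing (asymptoticSubalgebra φ))

instance : Module ℂ (AsymptoticSeq φ) := inferInstanceAs (Module ℂ (asymptoticSubalgebra φ))

instance : IsScalarTower ℂ (AsymptoticSeq φ) (AsymptoticSeq φ) :=
  inferInstanceAs (IsScalarTower ℂ (asymptoticSubalgebra φ) (asymptoticSubalgebra φ))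

instance : SMulCommClass ℂ (AsymptoticSeq φ) (AsymptoticSeq φ) :=
  inferInstanceAs (SMulCommClass ℂ (asymptoticSubalgebra φ) (asymptoticSubalgebra φ))

instance : StarRing (AsymptoticSeq φ) := inferInstanceAs (StarRing (asymptoticSubalgebra φ))

instance : StarModule ℂ (AsymptoticSeq φ) :=
  inferInstanceAs (StarModule ℂ (asymptoticSubalgebra φ))

/-- The underlying sequence. -/
def seq (f : AsymptoticSeq φ) : ∀ n, B n := f.1

/-- The seminorm `lim_n ‖f_n‖`. -/
def limNorm (f : AsymptoticSeq φ) : ℝ := limUnder atTop fun n => ‖seq f n‖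

theorem tendsto_limNorm (f : AsymptoticSeq φ) :
    Tendsto (fun n => ‖seq f n‖) atTop (𝓝 (limNorm f)) := by
  obtain ⟨l, hl⟩ := IsAsymptotic.tendsto_norm f.2
  have h : limNorm f = l := hl.limUnder_eq
  rw [h]
  exact hl

instance : SeminormedAddCommGroup (AsymptoticSeq φ) :=
  AddGroupSeminorm.toSeminormedAddCommGroup
    { toFun := limNorm
      map_zero' := tendsto_nhds_unique (tendsto_limNorm 0)
        (tendsto_const_nhds.congr fun n => (norm_zero (E := B n)).symm)
      add_le' := fun f g => le_of_tendsto_of_tendsto' (tendsto_limNorm (f + g))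
        ((tendsto_limNorm f).add (tendsto_limNorm g)) fun n => norm_add_le (seq f n) (seq g n)
      neg' := fun f => tendsto_nhds_unique (tendsto_limNorm (-f))
        ((tendsto_limNorm f).congr fun n => (norm_neg (seq f n)).symm) }

theorem tendsto_norm (f : AsymptoticSeq φ) : Tendsto (fun n => ‖seq f n‖) atTop (𝓝 ‖f‖) :=
  tendsto_limNorm f

instance : NonUnitalSeminormedRing (AsymptoticSeq φ) where
  norm_mul_le f g := le_of_tendsto_of_tendsto' (tendsto_norm (f * g))
    ((tendsto_norm f).mul (tendsto_norm g)) fun n => norm_mul_le (seq f n) (seq g n)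
  dist_eq _ _ := rfl

instance : NormedSpace ℂ (AsymptoticSeq φ) where
  norm_smul_le c f := (tendsto_nhds_unique (tendsto_norm (c • f))
    (((tendsto_norm f).const_mul ‖c‖).congr fun n => (norm_smul c (seq f n)).symm)).le

theorem norm_star_eq (f : AsymptoticSeq φ) : ‖star f‖ = ‖f‖ :=
  tendsto_nhds_unique (tendsto_norm (star f))
    ((tendsto_norm f).congr fun n => (norm_star (seq f n)).symm)

theorem norm_star_mul_self_eq (f : AsymptoticSeq φ) : ‖star f * f‖ = ‖f‖ * ‖f‖ :=
  tendsto_nhds_unique (tendsto_norm (star f * f))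
    (((tendsto_norm f).mul (tendsto_norm f)).congr fun n =>
      (CStarRing.norm_star_mul_self (x := seq f n)).symm)

theorem seq_sub (f g : AsymptoticSeq φ) (k : ℕ) : seq (f - g) k = seq f k - seq g k := rfl

/-- The element given by an asymptotically compatible sequence. -/
def ofSeq (f : ∀ n, B n) (hf : IsAsymptotic φ f) : AsymptoticSeq φ := ⟨f, hf⟩

theorem seq_ofSeq (f : ∀ n, B n) (hf : IsAsymptotic φ f) (k : ℕ) : seq (ofSeq f hf) k = f k := rfl

theorem isAsymptotic_seq (f : AsymptoticSeq φ) : IsAsymptotic φ (seq f) := f.2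

theorem exists_limit (F : ℕ → AsymptoticSeq φ)
    (hF' : ∀ i j, i ≤ j → ‖F i - F j‖ < (1 / 2 : ℝ) ^ i) :
    ∃ f : AsymptoticSeq φ, ∀ j, ‖F j - f‖ ≤ (1 / 2 : ℝ) ^ j := by
  have hN : ∀ j, ∃ N, (∀ n ≥ N, ∀ k, ∀ h : n ≤ k,
      ‖seq (F j) k - homTo φ h (seq (F j) n)‖ ≤ (1 / 2 : ℝ) ^ j) ∧
      ∀ k ≥ N, ∀ i ≤ j,
        ‖seq (F i) k - seq (F j) k‖ ≤ (1 / 2 : ℝ) ^ i := by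
    intro j
    obtain ⟨N₁, h₁⟩ := isAsymptotic_seq (F j) ((1 / 2 : ℝ) ^ j) (by positivity)
    have h₂ : ∀ᶠ k in atTop, ∀ i ∈ Finset.range (j + 1),
        ‖seq (F i) k - seq (F j) k‖ ≤ (1 / 2 : ℝ) ^ i := by
      rw [Filter.eventually_all_finset]
      intro i hi
      filter_upwards [(tendsto_norm (F i - F j)).eventually_lt_const
        (hF' i j (Nat.lt_succ_iff.1 (Finset.mem_range.1 hi)))] with k hk
      rw [seq_sub] at hk
      exact hk.le
    obtain ⟨N₂, h₂⟩ := eventually_atTop.1 h₂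
    exact ⟨max N₁ N₂, fun n hn k h => h₁ n (le_of_max_le_left hn) k h,
      fun k hk i hi => h₂ k (le_of_max_le_right hk) i (Finset.mem_range.2 (Nat.lt_succ_iff.2 hi))⟩
  choose N hN₁ hN₂ using hN
  obtain ⟨J, hJ, hmono⟩ : ∃ J : ℕ → ℕ,
      (∀ j k, max (N j) j ≤ k → j ≤ J k ∧ N (J k) ≤ k) ∧ Monotone J := by
    refine ⟨fun k => Nat.findGreatest (fun j => N j ≤ k) k, fun j k hk => ?_, fun n k h =>
      Nat.findGreatest_mono (fun j hj => le_trans hj h) h⟩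
    have h1 : j ≤ k := le_of_max_le_right hk
    have h2 : N j ≤ k := le_of_max_le_left hk
    exact ⟨Nat.le_findGreatest h1 h2, Nat.findGreatest_spec (P := fun j => N j ≤ k) h1 h2⟩
  have hpow : ∀ i j : ℕ, j ≤ i → (1 / 2 : ℝ) ^ i ≤ (1 / 2 : ℝ) ^ j := fun i j h =>
    pow_le_pow_of_le_one (by norm_num) (by norm_num) h
  have hf : IsAsymptotic φ (fun k => seq (F (J k)) k) := by
    intro ε hε
    obtain ⟨j, hj⟩ := exists_pow_lt_of_lt_one (half_pos hε) (by norm_num : (1 / 2 : ℝ) < 1)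
    refine ⟨max (N j) j, fun n hn k h => ?_⟩
    obtain ⟨h1, h2⟩ := hJ j n hn
    obtain ⟨h3, h4⟩ := hJ j k (le_trans hn h)
    have i1 := hN₁ (J n) n h2 k h
    have i2 := hN₂ (J k) k h4 (J n) (hmono h)
    have i3 := norm_sub_le_norm_sub_add_norm_sub (seq (F (J k)) k)
      (seq (F (J n)) k) (homTo φ h (seq (F (J n)) n))
    rw [norm_sub_rev] at i2
    have i4 := hpow (J n) j h1
    change ‖seq (F (J k)) k - homTo φ h (seq (F (J n)) n)‖ ≤ ε
    linarith
  refine ⟨ofSeq _ hf, fun j => le_of_tendsto (tendsto_norm _) ?_⟩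
  filter_upwards [eventually_ge_atTop (max (N j) j)] with k hk
  obtain ⟨h1, h2⟩ := hJ j k hk
  rw [seq_sub, seq_ofSeq]
  exact hN₂ (J k) k h2 j h1

end AsymptoticSeq

variable (φ) in
/-- The `C*`-algebraic inductive limit `lim (B_n, φ_n)`: asymptotically compatible sequences modulo
the sequences `f` with `‖f_n‖ → 0`, with the norm `lim_n ‖f_n‖`. -/
def CStarLimit : Type _ := SeparationQuotient (AsymptoticSeq φ)

namespace CStarLimit

instance : NonUnitalNormedRing (CStarLimit φ) :=
  inferInstanceAs (NonUnitalNormedRing (SeparationQuotient (AsymptoticSeq φ)))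

instance : NormedSpace ℂ (CStarLimit φ) :=
  inferInstanceAs (NormedSpace ℂ (SeparationQuotient (AsymptoticSeq φ)))

instance : IsScalarTower ℂ (CStarLimit φ) (CStarLimit φ) where
  smul_assoc c x y := by
    obtain ⟨f, rfl⟩ := SeparationQuotient.surjective_mk x
    obtain ⟨g, rfl⟩ := SeparationQuotient.surjective_mk y
    exact congrArg SeparationQuotient.mk (smul_mul_assoc c f g)

instance : SMulCommClass ℂ (CStarLimit φ) (CStarLimit φ) where
  smul_comm c x y := by
    obtain ⟨f, rfl⟩ := SeparationQuotient.surjective_mk x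
    obtain ⟨g, rfl⟩ := SeparationQuotient.surjective_mk y
    exact congrArg SeparationQuotient.mk (mul_smul_comm c f g).symm

/-- The class of an asymptotically compatible sequence. -/
def mk (f : AsymptoticSeq φ) : CStarLimit φ := SeparationQuotient.mk f

theorem mk_surjective : Function.Surjective (mk : AsymptoticSeq φ → CStarLimit φ) :=
  SeparationQuotient.surjective_mk

theorem norm_mk (f : AsymptoticSeq φ) : ‖mk f‖ = ‖f‖ := rfl

instance : Star (CStarLimit φ) where
  star := SeparationQuotient.lift (fun f => mk (star f)) fun f g h => by
    refine SeparationQuotient.mk_eq_mk.2 ?_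
    rw [Metric.inseparable_iff, dist_eq_norm] at h ⊢
    rw [← star_sub, AsymptoticSeq.norm_star_eq, h]

theorem star_mk (f : AsymptoticSeq φ) : star (mk f) = mk (star f) := rfl

instance : StarRing (CStarLimit φ) where
  star_involutive x := by
    obtain ⟨f, rfl⟩ := mk_surjective x
    exact congrArg mk (star_star f)
  star_mul x y := by
    obtain ⟨f, rfl⟩ := mk_surjective x
    obtain ⟨g, rfl⟩ := mk_surjective y
    exact congrArg mk (star_mul f g)
  star_add x y := by
    obtain ⟨f, rfl⟩ := mk_surjective x
    obtain ⟨g, rfl⟩ := mk_surjective y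
    exact congrArg mk (star_add f g)

instance : StarModule ℂ (CStarLimit φ) where
  star_smul c x := by
    obtain ⟨f, rfl⟩ := mk_surjective x
    exact congrArg mk (star_smul c f)

instance : CStarRing (CStarLimit φ) where
  norm_mul_self_le x := by
    obtain ⟨f, rfl⟩ := mk_surjective x
    exact (AsymptoticSeq.norm_star_mul_self_eq f).ge

instance : CompleteSpace (CStarLimit φ) := by
  refine Metric.complete_of_convergent_controlled_sequences (fun n => (1 / 2 : ℝ) ^ n)
    (fun n => by positivity) fun u hu => ?_
  choose F hF using fun j => mk_surjective (u j)
  have hsub : ∀ f g : AsymptoticSeq φ, ‖mk f - mk g‖ = ‖f - g‖ := fun f g => norm_mk (f - g)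
  obtain ⟨f, hf⟩ := AsymptoticSeq.exists_limit F fun i j hij => by
    have h := hu i i j le_rfl hij
    rwa [← hF i, ← hF j, dist_eq_norm, hsub] at h
  refine ⟨mk f, ?_⟩
  rw [tendsto_iff_norm_sub_tendsto_zero]
  refine squeeze_zero (fun j => norm_nonneg _) (fun j => ?_)
    (tendsto_pow_atTop_nhds_zero_of_lt_one (by norm_num) (by norm_num : (1 / 2 : ℝ) < 1))
  rw [← hF j, hsub]
  exact hf j

instance : NonUnitalCStarAlgebra (CStarLimit φ) where

variable (φ) in
/-- The canonical map `ι_n : B_n → lim (B_n, φ_n)`. -/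
def of (n : ℕ) : B n →⋆ₙₐ[ℂ] CStarLimit φ where
  toFun b := mk <| .ofSeq (fun k => if h : n ≤ k then homTo φ h b else 0) fun ε hε =>
    ⟨n, fun j hj k h => by
      beta_reduce
      rw [dif_pos (show n ≤ j from hj), dif_pos (show n ≤ k from le_trans hj h), homTo_trans,
        sub_self, norm_zero]
      exact hε.le⟩
  map_smul' c x := congrArg mk <| Subtype.ext <| funext fun k => by
    change (if h : n ≤ k then homTo φ h (c • x) else 0) =
      c • (if h : n ≤ k then homTo φ h x else 0)
    split_ifs <;> simp
  map_zero' := congrArg mk <| Subtype.ext <| funext fun k => by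
    change (if h : n ≤ k then homTo φ h 0 else 0) = 0
    split_ifs <;> simp
  map_add' x y := congrArg mk <| Subtype.ext <| funext fun k => by
    change (if h : n ≤ k then homTo φ h (x + y) else 0) =
      (if h : n ≤ k then homTo φ h x else 0) + (if h : n ≤ k then homTo φ h y else 0)
    split_ifs <;> simp
  map_mul' x y := congrArg mk <| Subtype.ext <| funext fun k => by
    change (if h : n ≤ k then homTo φ h (x * y) else 0) =
      (if h : n ≤ k then homTo φ h x else 0) * (if h : n ≤ k then homTo φ h y else 0)
    split_ifs <;> simp
  map_star' x := congrArg mk <| Subtype.ext <| funext fun k => by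
    change (if h : n ≤ k then homTo φ h (star x) else 0) =
      star (if h : n ≤ k then homTo φ h x else 0)
    split_ifs <;> simp [map_star]

end CStarLimit

end CStarLimit

/-! ### Unbounded operators -/

section Unbounded

variable {E F H : Type*} [NormedAddCommGroup E] [InnerProductSpace ℂ E]
  [NormedAddCommGroup F] [InnerProductSpace ℂ F] [NormedAddCommGroup H] [InnerProductSpace ℂ H]

/-- `V (dom D) ⊆ dom D'` and `D' V = V D` on `dom D`. -/
def Intertwines (V : E →ₗᵢ[ℂ] F) (D : E →ₗ.[ℂ] E) (D' : F →ₗ.[ℂ] F) : Prop :=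
  ∀ x : D.domain, ∃ h : V x ∈ D'.domain, D' ⟨V x, h⟩ = V (D x)

/-- The commutator `[D, a]` is defined on `dom D` (that is, `a (dom D) ⊆ dom D`) and extends to the
bounded operator `T`. -/
def CommutatorExtendsTo (D : H →ₗ.[ℂ] H) (a T : H →L[ℂ] H) : Prop :=
  ∀ x : D.domain, ∃ h : a x ∈ D.domain, D ⟨a x, h⟩ - a (D x) = T x

/-- `T` is the operator `(1 + D²)^{-1/2}`: `T` is positive and `T²` is the inverse of `1 + D²`
(with its natural domain). -/
def IsInvSqrtOneAddSq (D : H →ₗ.[ℂ] H) (T : H →L[ℂ] H) : Prop :=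
  T.IsPositive ∧ ∀ η : H, ∃ x y : D.domain, (x : H) = T (T η) ∧ (y : H) = D x ∧ (x : H) + D y = η

/-- The operator `(1 + D²)^{-1/2}` of a selfadjoint operator `D`. -/
def invSqrtOneAddSq (D : H →ₗ.[ℂ] H) : H →L[ℂ] H := Classical.epsilon (IsInvSqrtOneAddSq D)

variable [CompleteSpace H]

theorem exists_add_sq_eq {D : H →ₗ.[ℂ] H} (hD : IsSelfAdjoint D) (η : H) :
    ∃ x y : D.domain, (y : H) = D x ∧ (x : H) + D y = η := by
  let e := WithLp.prodContinuousLinearEquiv 2 ℂ H H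
  let G : Submodule ℂ (WithLp 2 (H × H)) := D.graph.comap (e : WithLp 2 (H × H) →ₗ[ℂ] H × H)
  have hG : IsClosed (G : Set (WithLp 2 (H × H))) := hD.isClosed.preimage e.continuous
  have : CompleteSpace G := hG.completeSpace_coe
  obtain ⟨g, hg, h, hh, hgh⟩ := G.exists_add_mem_mem_orthogonal (WithLp.toLp 2 (η, (0 : H)))
  have hg' : (g.fst, g.snd) ∈ D.graph := hg
  rw [LinearPMap.mem_graph_iff] at hg'
  obtain ⟨x, hx1, hx2⟩ := hg'
  simp only at hx1 hx2
  have e1 : η = g.fst + h.fst := congrArg WithLp.fst hgh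
  have e2 : 0 = g.snd + h.snd := congrArg WithLp.snd hgh
  have horth : ∀ z : D.domain, ⟪η - x, (z : H)⟫_ℂ = ⟪D x, D z⟫_ℂ := by
    intro z
    have hz : WithLp.toLp 2 ((z : H), D z) ∈ G := LinearPMap.mem_graph D z
    have := (Submodule.mem_orthogonal' G h).1 hh _ hz
    rw [WithLp.prod_inner_apply] at this
    have e3 : h.fst = η - x := by rw [e1, hx1]; abel
    have e4 : h.snd = - D x := by rw [hx2]; exact (neg_eq_of_add_eq_zero_right e2.symm).symm
    have h5 : ⟪h.fst, (z : H)⟫_ℂ + ⟪h.snd, D z⟫_ℂ = 0 := this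
    rw [e3, e4, inner_neg_left] at h5
    exact add_neg_eq_zero.1 h5
  have hadj : D.adjoint = D := hD
  have hy : D x ∈ D.adjoint.domain := D.mem_adjoint_domain_of_exists _ ⟨η - x, horth⟩
  have hy2 : D.adjoint ⟨D x, hy⟩ = η - x := LinearPMap.adjoint_apply_eq hD.dense_domain _ horth
  have hy' : D x ∈ D.domain := hadj.le.1 hy
  refine ⟨x, ⟨D x, hy'⟩, rfl, ?_⟩
  have : D ⟨D x, hy'⟩ = D.adjoint ⟨D x, hy⟩ := by
    have hle : D.adjoint ≤ D := hadj.le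
    exact (hle.2 (by rfl)).symm
  rw [this, hy2]
  abel

theorem inner_add_sq {D : H →ₗ.[ℂ] H} (hD : IsSelfAdjoint D) {x y : D.domain} (h : (y : H) = D x) :
    ⟪(x : H), (x : H) + D y⟫_ℂ = ((‖(x : H)‖ ^ 2 + ‖(y : H)‖ ^ 2 : ℝ) : ℂ) := by
  have hadj : D.adjoint = D := hD
  have hf : D.IsFormalAdjoint D := by
    have := LinearPMap.adjoint_isFormalAdjoint hD.dense_domain
    rwa [hadj] at this
  have h1 : ⟪D x, (y : H)⟫_ℂ = ⟪(x : H), D y⟫_ℂ := hf x y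
  rw [inner_add_right, ← h1, ← h, inner_self_eq_norm_sq_to_K (𝕜 := ℂ),
    inner_self_eq_norm_sq_to_K (𝕜 := ℂ)]
  push_cast
  rfl

theorem eq_of_add_sq_eq {D : H →ₗ.[ℂ] H} (hD : IsSelfAdjoint D) {x y x' y' : D.domain}
    (h : (y : H) = D x) (h' : (y' : H) = D x') (e : (x : H) + D y = x' + D y') : x = x' := by
  have h2 : ((y - y' : D.domain) : H) = D (x - x') := by
    rw [LinearPMap.map_sub, ← h, ← h']
    rfl
  have h1 := inner_add_sq hD h2
  have h3 : ((x - x' : D.domain) : H) + D (y - y') = 0 := by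
    rw [LinearPMap.map_sub, Submodule.coe_sub, sub_add_sub_comm, e, sub_self]
  rw [h3, inner_zero_right] at h1
  have h4 : (0 : ℝ) = ‖((x - x' : D.domain) : H)‖ ^ 2 + ‖((y - y' : D.domain) : H)‖ ^ 2 := by
    exact_mod_cast h1
  have h5 : ((x - x' : D.domain) : H) = 0 := by
    rw [← norm_eq_zero, ← sq_eq_zero_iff]
    nlinarith [sq_nonneg ‖((x - x' : D.domain) : H)‖, sq_nonneg ‖((y - y' : D.domain) : H)‖]
  exact sub_eq_zero.1 (Subtype.ext h5)

/-- For a selfadjoint operator `D`, the operator `(1 + D²)^{-1/2}` exists and is unique. -/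
theorem existsUnique_invSqrtOneAddSq {D : H →ₗ.[ℂ] H} (hD : IsSelfAdjoint D) :
    ∃! T, IsInvSqrtOneAddSq D T := by
  choose X Y hXY hη using exists_add_sq_eq hD
  have hn : ∀ η, ‖((X η : D.domain) : H)‖ ≤ 1 * ‖η‖ := by
    intro η
    have h1 := inner_add_sq hD (hXY η)
    rw [hη] at h1
    have h2 : ‖⟪((X η : D.domain) : H), η⟫_ℂ‖ = ‖(X η : H)‖ ^ 2 + ‖(Y η : H)‖ ^ 2 := by
      rw [h1, Complex.norm_real, Real.norm_of_nonneg (by positivity)]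
    have h3 := norm_inner_le_norm (𝕜 := ℂ) ((X η : D.domain) : H) η
    rw [h2] at h3
    by_contra hc
    nlinarith [norm_nonneg (X η : H), norm_nonneg η, sq_nonneg ‖(Y η : H)‖]
  let R : H →L[ℂ] H := LinearMap.mkContinuous
    { toFun := fun η => X η
      map_add' := fun a b => by
        rw [← Submodule.coe_add]
        refine congrArg _ (eq_of_add_sq_eq hD (hXY _) (y' := Y a + Y b) ?_ ?_)
        · rw [LinearPMap.map_add, ← hXY, ← hXY]
          rfl
        · rw [LinearPMap.map_add, hη, Submodule.coe_add, add_add_add_comm, hη, hη]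
      map_smul' := fun c a => by
        rw [RingHom.id_apply, ← Submodule.coe_smul]
        refine congrArg _ (eq_of_add_sq_eq hD (hXY _) (y' := c • Y a) ?_ ?_)
        · rw [LinearPMap.map_smul, ← hXY]
          rfl
        · rw [LinearPMap.map_smul, hη, Submodule.coe_smul, ← smul_add, hη] } 1 hn
  have hR : ∀ η, R η = X η := fun η => rfl
  have hpos : 0 ≤ R := by
    rw [ContinuousLinearMap.nonneg_iff_isPositive, ContinuousLinearMap.isPositive_iff_complex]
    intro η
    have h1 := inner_add_sq hD (hXY η)
    rw [hη] at h1
    rw [hR, h1]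
    exact ⟨congrArg _ (Complex.ofReal_re _), by rw [RCLike.re_to_complex, Complex.ofReal_re]; positivity⟩
  have huniq : ∀ T, IsInvSqrtOneAddSq D T → T * T = R := by
    rintro T ⟨-, hT⟩
    ext η
    obtain ⟨x, y, hx, hy, hxy⟩ := hT η
    have : x = X η := eq_of_add_sq_eq hD hy (hXY η) (by rw [hxy, hη])
    rw [hR, ← this, hx]
    rfl
  refine ⟨CFC.sqrt R, ⟨?_, fun η => ⟨X η, Y η, ?_, hXY η, hη η⟩⟩, fun T hT => ?_⟩
  · exact (ContinuousLinearMap.nonneg_iff_isPositive _).1 (CFC.sqrt_nonneg R)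
  · exact (congrArg (fun T : H →L[ℂ] H => T η) (CFC.sqrt_mul_sqrt_self R hpos)).symm
  · exact (CFC.sqrt_unique (huniq T hT)
      ((ContinuousLinearMap.nonneg_iff_isPositive _).2 hT.1)).symm

end Unbounded

/-! ### Locally compact spectral triples -/

/-- A representation is nondegenerate if the vectors `π(a) x` span a dense subspace. -/
def IsNondegenerateRep {A H : Type*} [NonUnitalCStarAlgebra A] [NormedAddCommGroup H]
    [InnerProductSpace ℂ H] [CompleteSpace H] (π : A →⋆ₙₐ[ℂ] (H →L[ℂ] H)) : Prop :=
  Dense (Submodule.span ℂ {y : H | ∃ a x, y = π a x} : Set H)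

/-- `π(a)(1 + D²)^{-1/2}` is compact for all `a ∈ 𝒜`. -/
def IsLocallyCompactOn {A H : Type*} [NonUnitalCStarAlgebra A] [NormedAddCommGroup H]
    [InnerProductSpace ℂ H] [CompleteSpace H] (𝒜 : NonUnitalStarSubalgebra ℂ A)
    (π : A →⋆ₙₐ[ℂ] (H →L[ℂ] H)) (D : H →ₗ.[ℂ] H) : Prop :=
  ∀ a ∈ 𝒜, IsCompactOperator (π a ∘L invSqrtOneAddSq D)

/-- `(𝒜, H, D)` is a locally compact (nonunital) spectral triple on the `C*`-algebra `A`, with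
representation `π`. -/
structure IsLocallyCompactSpectralTriple {A H : Type*} [NonUnitalCStarAlgebra A]
    [NormedAddCommGroup H] [InnerProductSpace ℂ H] [CompleteSpace H]
    (𝒜 : NonUnitalStarSubalgebra ℂ A) (π : A →⋆ₙₐ[ℂ] (H →L[ℂ] H)) (D : H →ₗ.[ℂ] H) : Prop where
  faithful : Function.Injective π
  nondegenerate : IsNondegenerateRep π
  selfAdjoint : IsSelfAdjoint D
  dense : Dense (𝒜 : Set A)
  bounded_commutator : ∀ a ∈ 𝒜, ∃ T, CommutatorExtendsTo D (π a) T
  locally_compact : IsLocallyCompactOn 𝒜 π D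

/-! ### Protoral systems and Morita-compatible Dirac structures -/

/-- A protoral inductive system `B_0 → B_1 → ⋯`: `B_n = M_{r_n}(A_{Θ_n})` with `r_n ≥ 1`,
`Θ_n` a nondegenerate skew-symmetric real matrix of size `d_n ≥ 2`, and nonzero
`*`-homomorphisms `φ_n : B_n → B_{n+1}`. -/
structure ProtoralSystem where
  d : ℕ → ℕ
  two_le_d : ∀ n, 2 ≤ d n
  r : ℕ → ℕ
  one_le_r : ∀ n, 1 ≤ r n
  Θ : ∀ n, Matrix (Fin (d n)) (Fin (d n)) ℝ
  skew : ∀ n, (Θ n).transpose = -Θ n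
  nondegenerate : ∀ n, IsNondegenerate (Θ n)
  φ : ∀ n, MatTorus (r n) (Θ n) →⋆ₙₐ[ℂ] MatTorus (r (n + 1)) (Θ (n + 1))
  φ_ne_zero : ∀ n, φ n ≠ 0

namespace ProtoralSystem

variable (X : ProtoralSystem)

/-- The `C*`-algebra `B_n = M_{r_n}(A_{Θ_n})`. -/
abbrev B (n : ℕ) : Type := MatTorus (X.r n) (X.Θ n)

/-- The normalized trace on `B_n`. -/
abbrev τ (n : ℕ) : X.B n →ₚ[ℂ] ℂ := MatTorus.trace

/-- The protorus `A_pro = lim (B_n, φ_n)`. -/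
abbrev Apro : Type := CStarLimit X.φ

/-- The canonical map `ι_n : B_n → A_pro`. -/
abbrev ι (n : ℕ) : X.B n →⋆ₙₐ[ℂ] X.Apro := CStarLimit.of X.φ n

/-- The projection `e_n = ι_n(1)`. -/
def e (n : ℕ) : X.Apro := X.ι n 1

/-- The connecting map `φ_{n,m} : B_n → B_m` for `n ≤ m`. -/
abbrev φTo {n m : ℕ} (h : n ≤ m) : X.B n →⋆ₙₐ[ℂ] X.B m := homTo X.φ h

/-- A `*`-subalgebra `𝒜` of `A_pro` that is dense, whose elements are all supported in some finite
stage (`a = e_n a e_n` for some `n`), and that contains every `e_n`. -/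
structure IsFinitelySupported (𝒜 : NonUnitalStarSubalgebra ℂ X.Apro) : Prop where
  dense : Dense (𝒜 : Set X.Apro)
  supported : ∀ a ∈ 𝒜, ∃ n, a = X.e n * a * X.e n
  e_mem : ∀ n, X.e n ∈ 𝒜

end ProtoralSystem

/-- A smooth factorization `φ_n = ι_{p_n} ∘ α_n ∘ ψ_n` of the connecting maps, where
`ψ_n = Id ⊗ φ_{M,z} : B_n → C_n = M_{r_n}(A_{Ψ_n})` is a unital toric map (the identity is the toric
map with `M = 1` and `z = 1`), `p_n ∈ B_{n+1}^∞` is a full projection, and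
`α_n : C_n ≅ p_n B_{n+1} p_n` restricts to a Fréchet `*`-isomorphism of the smooth subalgebras. -/
structure SmoothFactorization (X : ProtoralSystem) where
  dC : ℕ → ℕ
  Ψ : ∀ n, Matrix (Fin (dC n)) (Fin (dC n)) ℝ
  skew : ∀ n, (Ψ n).transpose = -Ψ n
  ψ : ∀ n, NCTorus (X.Θ n) →⋆ₐ[ℂ] NCTorus (Ψ n)
  toric : ∀ n, IsToric (ψ n)
  p : ∀ n, X.B (n + 1)
  isStarProjection : ∀ n, IsStarProjection (p n)
  smooth_p : ∀ n, (p n).IsSmooth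
  full_p : ∀ n, IsFull (p n)
  α : ∀ n, MatTorus (X.r n) (Ψ n) ≃⋆ₐ[ℂ] Corner (p n) (isStarProjection n)
  image_smooth : ∀ n,
    (fun c => Corner.incl (p n) (isStarProjection n) (α n c)) '' {c | c.IsSmooth} =
      {x | ∃ b : X.B (n + 1), b.IsSmooth ∧ x = p n * b * p n}
  continuous_α : ∀ n k, ∃ (l : ℕ) (C : ℝ), ∀ c : MatTorus (X.r n) (Ψ n), c.IsSmooth →
    (Corner.incl (p n) (isStarProjection n) (α n c)).smoothSeminorm k ≤ C * ∑ i ∈ Finset.range l,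
      c.smoothSeminorm i
  continuous_α_symm : ∀ n k, ∃ (l : ℕ) (C : ℝ), ∀ c : MatTorus (X.r n) (Ψ n), c.IsSmooth →
    c.smoothSeminorm k ≤ C * ∑ i ∈ Finset.range l,
      (Corner.incl (p n) (isStarProjection n) (α n c)).smoothSeminorm i
  factor : ∀ n b, X.φ n b =
    Corner.incl (p n) (isStarProjection n) (α n (MatTorus.amplify (X.r n) (ψ n) b))

namespace SmoothFactorization

variable {X : ProtoralSystem} (F : SmoothFactorization X)

/-- The intermediate matrix-amplified torus `C_n = M_{r_n}(A_{Ψ_n})`. -/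
abbrev C (n : ℕ) : Type := MatTorus (X.r n) (F.Ψ n)

/-- The normalized trace `ω_n` on `C_n`. -/
abbrev ω (n : ℕ) : F.C n →ₚ[ℂ] ℂ := MatTorus.trace

/-- The corner `p_n B_{n+1} p_n`. -/
abbrev corner (n : ℕ) : Type := Corner (F.p n) (F.isStarProjection n)

/-- The normalized trace `τ_{p_n} = τ_{n+1} / τ_{n+1}(p_n)` on the corner. -/
abbrev τp (n : ℕ) : F.corner n →ₚ[ℂ] ℂ := Corner.trace (F.p n) (F.isStarProjection n) (X.τ (n + 1))

/-- The corner inclusion `ι_{p_n}`. -/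
abbrev incl (n : ℕ) : F.corner n →⋆ₙₐ[ℂ] X.B (n + 1) := Corner.incl (F.p n) (F.isStarProjection n)

/-- The amplified toric map `ψ_n : B_n → C_n`. -/
abbrev toricMap (n : ℕ) (b : X.B n) : F.C n := MatTorus.amplify (X.r n) (F.ψ n) b

end SmoothFactorization

/-- A Morita-compatible Dirac structure on a protoral system. -/
structure MoritaDirac (X : ProtoralSystem) extends SmoothFactorization X where
  /-- The spinor spaces `S_n`, `S_n^C` and `S_{n+1}^{(p_n)}`. -/
  S : ℕ → Type
  SC : ℕ → Type
  Sp : ℕ → Type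
  [normedS : ∀ n, NormedAddCommGroup (S n)]
  [innerS : ∀ n, InnerProductSpace ℂ (S n)]
  [finiteS : ∀ n, FiniteDimensional ℂ (S n)]
  /-- `S_n ≠ 0`, so that the representation of `B_n` on `L²(B_n, τ_n) ⊗ S_n` is faithful. -/
  nontrivial_S : ∀ n, Nontrivial (S n)
  [normedSC : ∀ n, NormedAddCommGroup (SC n)]
  [innerSC : ∀ n, InnerProductSpace ℂ (SC n)]
  [finiteSC : ∀ n, FiniteDimensional ℂ (SC n)]
  [normedSp : ∀ n, NormedAddCommGroup (Sp n)]
  [innerSp : ∀ n, InnerProductSpace ℂ (Sp n)]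
  [finiteSp : ∀ n, FiniteDimensional ℂ (Sp n)]
  /-- The selfadjoint operators `D_n`, `D_n^C` and `D_{n+1}^{(p_n)}`. -/
  D : ∀ n, L2Tensor (X.τ n) (S n) →ₗ.[ℂ] L2Tensor (X.τ n) (S n)
  DC : ∀ n, L2Tensor (toSmoothFactorization.ω n) (SC n) →ₗ.[ℂ]
    L2Tensor (toSmoothFactorization.ω n) (SC n)
  Dp : ∀ n, L2Tensor (toSmoothFactorization.τp n) (Sp n) →ₗ.[ℂ]
    L2Tensor (toSmoothFactorization.τp n) (Sp n)
  selfAdjoint_D : ∀ n, IsSelfAdjoint (D n)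
  selfAdjoint_DC : ∀ n, IsSelfAdjoint (DC n)
  selfAdjoint_Dp : ∀ n, IsSelfAdjoint (Dp n)
  /-- The isometries `I_{ψ_n}`, `I_{α_n}` and `I_{ι_{p_n}}`. -/
  Iψ : ∀ n, L2Tensor (X.τ n) (S n) →ₗᵢ[ℂ] L2Tensor (toSmoothFactorization.ω n) (SC n)
  Iα : ∀ n, L2Tensor (toSmoothFactorization.ω n) (SC n) →ₗᵢ[ℂ]
    L2Tensor (toSmoothFactorization.τp n) (Sp n)
  Iι : ∀ n, L2Tensor (toSmoothFactorization.τp n) (Sp n) →ₗᵢ[ℂ]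
    L2Tensor (X.τ (n + 1)) (S (n + 1))
  intertwines_ψ : ∀ n, Intertwines (Iψ n) (D n) (DC n)
  intertwines_α : ∀ n, Intertwines (Iα n) (DC n) (Dp n)
  intertwines_ι : ∀ n, Intertwines (Iι n) (Dp n) (D (n + 1))
  rep_ψ : ∀ n (b : X.B n) η, Iψ n (L2Tensor.leftMul (X.τ n) b η) =
    L2Tensor.leftMul (toSmoothFactorization.ω n) (toSmoothFactorization.toricMap n b) (Iψ n η)
  rep_α : ∀ n (c : toSmoothFactorization.C n) η,
    Iα n (L2Tensor.leftMul (toSmoothFactorization.ω n) c η) =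
      L2Tensor.leftMul (toSmoothFactorization.τp n) (α n c) (Iα n η)
  rep_ι : ∀ n (x : toSmoothFactorization.corner n) η,
    Iι n (L2Tensor.leftMul (toSmoothFactorization.τp n) x η) =
      L2Tensor.leftMul (X.τ (n + 1)) (toSmoothFactorization.incl n x) (Iι n η)
  /-- The spinor isometries `J_n`. -/
  J : ∀ n, S n →ₗᵢ[ℂ] S (n + 1)
  /-- The composite is the trace-rescaled GNS isometry
  `Λ_n(a) ⊗ ξ ↦ t_n^{-1/2} Λ_{n+1}(φ_n(a)) ⊗ J_n ξ`, with `t_n = τ_{n+1}(φ_n(1))`. -/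
  rescaled : ∀ n (a : X.B n) (ξ : S n), Iι n (Iα n (Iψ n (L2Tensor.vec (X.τ n) a ξ))) =
    ((√(X.τ (n + 1) (X.φ n 1)).re)⁻¹ : ℂ) • L2Tensor.vec (X.τ (n + 1)) (X.φ n a) (J n ξ)

namespace MoritaDirac

attribute [instance] MoritaDirac.normedS MoritaDirac.innerS MoritaDirac.finiteS
  MoritaDirac.normedSC MoritaDirac.innerSC MoritaDirac.finiteSC
  MoritaDirac.normedSp MoritaDirac.innerSp MoritaDirac.finiteSp

variable {X : ProtoralSystem} (M : MoritaDirac X)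

/-- The Hilbert space `H_n = L²(B_n, τ_n) ⊗ S_n`. -/
abbrev H (n : ℕ) : Type := L2Tensor (X.τ n) (M.S n)

/-- The representation `π_n` of `B_n` on `H_n` by left multiplication. -/
abbrev rep (n : ℕ) (b : X.B n) : M.H n →L[ℂ] M.H n := L2Tensor.leftMul (X.τ n) b

/-- The isometry `I_n = I_{ι_{p_n}} ∘ I_{α_n} ∘ I_{ψ_n} : H_n → H_{n+1}`. -/
def I (n : ℕ) : M.H n →ₗᵢ[ℂ] M.H (n + 1) := (M.Iι n).comp ((M.Iα n).comp (M.Iψ n))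

/-- The isometry `I_{m,k} : H_m → H_k` for `m ≤ k`. -/
abbrev ITo {m k : ℕ} (h : m ≤ k) : M.H m →ₗᵢ[ℂ] M.H k := isometryTo (E := M.H) M.I h

/-- The Hilbert space `H_pro = lim (H_n, I_n)`. -/
abbrev Hpro : Type := HilbertLimit (E := M.H) M.I

/-- The canonical isometry `I_{n,∞} : H_n → H_pro`. -/
abbrev Iinf (n : ℕ) : M.H n →ₗᵢ[ℂ] M.Hpro := toHilbertLimit (E := M.H) M.I n

/-- The operator `D_0` with domain `⋃ I_{n,∞}(dom D_n)` and `D_0 I_{n,∞} ξ = I_{n,∞} D_n ξ`; its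
graph is the increasing union of the images of the graphs of the `D_n`. -/
def D₀ : M.Hpro →ₗ.[ℂ] M.Hpro :=
  (⨆ n, (M.D n).graph.map
    ((M.Iinf n).toLinearMap.prodMap (M.Iinf n).toLinearMap)).toLinearPMap

/-- The operator `D_pro`, the closure of `D_0`. -/
def Dpro : M.Hpro →ₗ.[ℂ] M.Hpro := M.D₀.closure

/-- `π` is the limit representation of `A_pro` on `H_pro`:
`π(ι_n(b)) I_{m,∞} η = I_{k,∞} π_k(φ_{n,k}(b)) I_{m,k} η` for `k ≥ n, m`. As the `ι_n(B_n)` and the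
`I_{m,∞} H_m` have dense union, this determines `π`. -/
def IsLimitRep (π : X.Apro →⋆ₙₐ[ℂ] (M.Hpro →L[ℂ] M.Hpro)) : Prop :=
  ∀ (n m k : ℕ) (hn : n ≤ k) (hm : m ≤ k) (b : X.B n) (η : M.H m),
    π (X.ι n b) (M.Iinf m η) = M.Iinf k (M.rep k (X.φTo hn b) (M.ITo hm η))

/-- The stagewise commutators `[D_m, π_m(φ_{n,m}(a))]`, `m ≥ n`, extend to bounded operators, with
uniformly bounded norms. -/
def StagewiseBounded {n : ℕ} (a : X.B n) : Prop :=
  ∃ C : ℝ, ∀ (m : ℕ) (h : n ≤ m), ∃ T : M.H m →L[ℂ] M.H m,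
    CommutatorExtendsTo (M.D m) (M.rep m (X.φTo h a)) T ∧ ‖T‖ ≤ C

end MoritaDirac

end Protorus

end


/-!
All the structure in the theorem is that of an inductive system of Hilbert spaces with compatible
selfadjoint operators and representations; the tori enter only through the faithfulness of the
stage representations.

*Selfadjointness.* The graph of the limit operator is the closure of the increasing union of the
stage graphs. If `(y, w)` lies in the adjoint graph, its compression to stage `n` lies in the
adjoint graph of the selfadjoint operator `D_n`, that is, in the graph of `D_n`. The projections
onto the stages converge strongly to the identity, so `(y, w)` is a limit of elements of stage
graphs.

*Commutators.* A bounded extension of a commutator in the limit compresses, along the isometry of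
stage `n`, to a bounded extension at stage `n` of at most the same norm. Conversely, bounded
extensions at the stages are determined by their values on a dense domain, hence are compatible
with the isometries, and a uniform bound allows them to pass to the limit.

*Faithfulness.* An injective `*`-homomorphism of `C*`-algebras is isometric, and a limit of
isometries is isometric, so it suffices that each stage representation is injective, which follows
once the trace is faithful. If `τ(a* a) = 0`, then `a δ_0 = 0`; the right translations commute with
the torus and carry `δ_0` to every `δ_x`, whence `a = 0`.

*Local compactness.* Since `a = a e_n` for some `n`, the operator `π(a) (1 + D²)^{-1/2}` is a
bounded multiple of `π(e_n) (1 + D²)^{-1/2}`.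
-/

noncomputable section

namespace Protorus

open scoped ComplexOrder TensorProduct InnerProductSpace
open Filter Topology

/-! ### Inductive limits of Hilbert spaces -/

section HilbertLimit

variable {E F : ℕ → Type*} [∀ n, NormedAddCommGroup (E n)] [∀ n, InnerProductSpace ℂ (E n)]
  [∀ n, NormedAddCommGroup (F n)] [∀ n, InnerProductSpace ℂ (F n)]
  (V : ∀ n, E n →ₗᵢ[ℂ] E (n + 1)) (W : ∀ n, F n →ₗᵢ[ℂ] F (n + 1))

theorem isometryTo_trans {n k l : ℕ} (h : n ≤ k) (h' : k ≤ l) (x : E n) :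
    isometryTo V h' (isometryTo V h x) = isometryTo V (h.trans h') x := by
  induction l, h' using Nat.le_induction with
  | base => rw [isometryTo_self]
  | succ l hl ih => rw [isometryTo_succ V hl, ih, isometryTo_succ V (h.trans hl)]

namespace PreHilbertLimit

variable {V}

theorem eventually_seq_succ (f : PreHilbertLimit V) :
    ∀ᶠ n in atTop, seq f (n + 1) = V n (seq f n) :=
  f.2

theorem eventually_norm (f : PreHilbertLimit V) : ∀ᶠ n in atTop, ‖seq f n‖ = ‖f‖ := by
  filter_upwards [eventually_inner f f] with n hn
  rw [norm_eq_sqrt_re_inner (𝕜 := ℂ) f, inner_def, ← hn, ← norm_eq_sqrt_re_inner]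

theorem seq_toPreHilbertLimit {n k : ℕ} (h : n ≤ k) (x : E n) :
    seq (toPreHilbertLimit V n x) k = isometryTo V h x :=
  dif_pos h

end PreHilbertLimit

open PreHilbertLimit

theorem denseRange_ofPreHilbertLimit : DenseRange (ofPreHilbertLimit V) :=
  UniformSpace.Completion.denseRange_coe

theorem ofPreHilbertLimit_eq_of_eventually {f g : PreHilbertLimit V}
    (h : ∀ᶠ n in atTop, seq f n = seq g n) : ofPreHilbertLimit V f = ofPreHilbertLimit V g := by
  obtain ⟨n, hn, hfg⟩ := ((eventually_norm (f - g)).and h).exists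
  rw [← sub_eq_zero, ← map_sub, ← norm_eq_zero, LinearIsometry.norm_map, ← hn, map_sub,
    Pi.sub_apply, hfg, sub_self, norm_zero]

theorem toHilbertLimit_apply (n : ℕ) (x : E n) :
    toHilbertLimit V n x = ofPreHilbertLimit V (toPreHilbertLimit V n x) :=
  rfl

theorem toHilbertLimit_isometryTo {n k : ℕ} (h : n ≤ k) (x : E n) :
    toHilbertLimit V k (isometryTo V h x) = toHilbertLimit V n x := by
  rw [toHilbertLimit_apply, toHilbertLimit_apply]
  refine ofPreHilbertLimit_eq_of_eventually V ?_
  filter_upwards [eventually_ge_atTop k] with l hl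
  rw [seq_toPreHilbertLimit hl, seq_toPreHilbertLimit (h.trans hl), isometryTo_trans]

theorem toHilbertLimit_succ (n : ℕ) (x : E n) :
    toHilbertLimit V (n + 1) (V n x) = toHilbertLimit V n x := by
  rw [← toHilbertLimit_isometryTo V n.le_succ, isometryTo_succ V le_rfl, isometryTo_self]

theorem exists_toHilbertLimit_eq (f : PreHilbertLimit V) (n₀ : ℕ) :
    ∃ n ≥ n₀, ∃ x : E n, toHilbertLimit V n x = ofPreHilbertLimit V f := by
  obtain ⟨n, hf, hn⟩ := ((eventually_forall_ge_atTop.2 (eventually_seq_succ f)).and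
    (eventually_ge_atTop n₀)).exists
  refine ⟨n, hn, seq f n, ?_⟩
  rw [toHilbertLimit_apply]
  refine ofPreHilbertLimit_eq_of_eventually V ?_
  filter_upwards [eventually_ge_atTop n] with k hk
  rw [seq_toPreHilbertLimit hk]
  induction k, hk using Nat.le_induction with
  | base => rw [isometryTo_self]
  | succ k hk ih => rw [isometryTo_succ V hk, ih, hf k hk]

theorem dense_toHilbertLimit (n₀ : ℕ) :
    Dense {y : HilbertLimit V | ∃ n ≥ n₀, ∃ x : E n, toHilbertLimit V n x = y} := by
  refine (denseRange_ofPreHilbertLimit V).mono ?_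
  rintro _ ⟨f, rfl⟩
  exact exists_toHilbertLimit_eq V f n₀

namespace HilbertLimit

variable {V}

theorem clm_ext {G : Type*} [NormedAddCommGroup G] [NormedSpace ℂ G] (n₀ : ℕ)
    {T S : HilbertLimit V →L[ℂ] G}
    (h : ∀ n ≥ n₀, ∀ x : E n, T (toHilbertLimit V n x) = S (toHilbertLimit V n x)) : T = S := by
  refine ContinuousLinearMap.coeFn_injective
    (Continuous.ext_on (dense_toHilbertLimit V n₀) T.continuous S.continuous ?_)
  rintro _ ⟨n, hn, x, rfl⟩
  exact h n hn x

theorem induction_pair (n₀ : ℕ) {P : HilbertLimit V → HilbertLimit V → Prop}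
    (hP : IsClosed {q : HilbertLimit V × HilbertLimit V | P q.1 q.2})
    (h : ∀ n ≥ n₀, ∀ x y : E n, P (toHilbertLimit V n x) (toHilbertLimit V n y))
    (x y : HilbertLimit V) : P x y := by
  have hdense := (dense_toHilbertLimit V n₀).prod (dense_toHilbertLimit V n₀)
  refine closure_minimal ?_ hP (hdense (x, y))
  rintro ⟨_, _⟩ ⟨⟨n, hn, u, rfl⟩, ⟨m, -, v, rfl⟩⟩
  rw [← toHilbertLimit_isometryTo V (le_max_left n m),
    ← toHilbertLimit_isometryTo V (le_max_right n m)]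
  exact h _ (hn.le.trans (le_max_left n m)) _ _

end HilbertLimit

section LimitMap

variable {V W} {n₀ : ℕ} (T : ∀ n, n₀ ≤ n → E n →L[ℂ] F n)
  (hT : ∀ n h x, T (n + 1) (Nat.le_succ_of_le h) (V n x) = W n (T n h x))

/-- The action of compatible operators `T_n`, `n ≥ n₀`, on the algebraic inductive limits; the
finitely many terms below `n₀` are irrelevant and set to `0`. -/
def preLimitMap : PreHilbertLimit V →ₗ[ℂ] PreHilbertLimit W where
  toFun f := ⟨fun n => (if h : n₀ ≤ n then T n h else 0) (seq f n), by
    filter_upwards [eventually_seq_succ f, eventually_ge_atTop n₀] with n hf hn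
    rw [dif_pos hn, dif_pos (Nat.le_succ_of_le hn), hf, hT]⟩
  map_add' f g := Subtype.ext <| funext fun n => map_add (dite ..) (seq f n) (seq g n)
  map_smul' c f := Subtype.ext <| funext fun n => map_smul (dite ..) c (seq f n)

theorem seq_preLimitMap {n : ℕ} (h : n₀ ≤ n) (f : PreHilbertLimit V) :
    seq (preLimitMap T hT f) n = T n h (seq f n) := by
  change (if h : n₀ ≤ n then T n h else 0) (seq f n) = _
  rw [dif_pos h]

/-- The operator `lim T_n` induced by uniformly bounded operators `T_n`, `n ≥ n₀`, that are
compatible with the isometries of the two inductive systems. Without a uniform bound this is the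
junk value of `LinearMap.extendOfNorm`. -/
def limitMap : HilbertLimit V →L[ℂ] HilbertLimit W :=
  ((ofPreHilbertLimit W).toLinearMap ∘ₗ preLimitMap T hT).extendOfNorm
    (ofPreHilbertLimit V).toLinearMap

variable {C : ℝ} (hC : ∀ n h, ‖T n h‖ ≤ C)

include hC

theorem norm_preLimitMap_le (f : PreHilbertLimit V) : ‖preLimitMap T hT f‖ ≤ C * ‖f‖ := by
  obtain ⟨n, ⟨hf, hTf⟩, hn⟩ := (((eventually_norm f).and
    (eventually_norm (preLimitMap T hT f))).and (eventually_ge_atTop n₀)).exists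
  rw [← hf, ← hTf, seq_preLimitMap T hT hn]
  exact (T n hn).le_of_opNorm_le (hC n hn) _

theorem limitMap_ofPreHilbertLimit (f : PreHilbertLimit V) :
    limitMap T hT (ofPreHilbertLimit V f) = ofPreHilbertLimit W (preLimitMap T hT f) :=
  LinearMap.extendOfNorm_eq (denseRange_ofPreHilbertLimit V)
    ⟨C, fun f => by simpa using norm_preLimitMap_le T hT hC f⟩ f

theorem limitMap_toHilbertLimit {n : ℕ} (h : n₀ ≤ n) (x : E n) :
    limitMap T hT (toHilbertLimit V n x) = toHilbertLimit W n (T n h x) := by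
  rw [toHilbertLimit_apply, toHilbertLimit_apply, limitMap_ofPreHilbertLimit T hT hC]
  refine ofPreHilbertLimit_eq_of_eventually W ?_
  filter_upwards [eventually_ge_atTop n] with k hk
  rw [seq_preLimitMap T hT (h.trans hk), seq_toPreHilbertLimit hk, seq_toPreHilbertLimit hk]
  induction k, hk using Nat.le_induction with
  | base => rw [isometryTo_self, isometryTo_self]
  | succ k hk ih => rw [isometryTo_succ V hk, isometryTo_succ W hk, hT k (h.trans hk), ih]

end LimitMap

section Projection

theorem adjoint_apply_map {E F : Type*} [NormedAddCommGroup E] [InnerProductSpace ℂ E]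
    [CompleteSpace E] [NormedAddCommGroup F] [InnerProductSpace ℂ F] [CompleteSpace F]
    (W : E →ₗᵢ[ℂ] F) (x : E) : W.toContinuousLinearMap.adjoint (W x) = x :=
  DFunLike.congr_fun W.adjoint_comp_self x

theorem norm_adjoint_toContinuousLinearMap_le {E F : Type*} [NormedAddCommGroup E]
    [InnerProductSpace ℂ E] [CompleteSpace E] [NormedAddCommGroup F] [InnerProductSpace ℂ F]
    [CompleteSpace F] (W : E →ₗᵢ[ℂ] F) : ‖W.toContinuousLinearMap.adjoint‖ ≤ 1 := by
  rw [LinearIsometryEquiv.norm_map]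
  exact W.norm_toContinuousLinearMap_le

variable [∀ n, CompleteSpace (E n)]

/-- The orthogonal projection `V_{n,∞} V_{n,∞}^*` onto the image of the `n`-th stage. -/
def stageProjection (n : ℕ) : HilbertLimit V →L[ℂ] HilbertLimit V :=
  (toHilbertLimit V n).toContinuousLinearMap ∘L
    (toHilbertLimit V n).toContinuousLinearMap.adjoint

theorem norm_stageProjection_le (n : ℕ) : ‖stageProjection V n‖ ≤ 1 :=
  (ContinuousLinearMap.opNorm_comp_le _ _).trans <|
    mul_le_one₀ (toHilbertLimit V n).norm_toContinuousLinearMap_le (norm_nonneg _)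
      (norm_adjoint_toContinuousLinearMap_le _)

theorem stageProjection_toHilbertLimit {n k : ℕ} (h : n ≤ k) (x : E n) :
    stageProjection V k (toHilbertLimit V n x) = toHilbertLimit V n x := by
  rw [← toHilbertLimit_isometryTo V h]
  exact congrArg (toHilbertLimit V k) (adjoint_apply_map _ _)

theorem tendsto_stageProjection (x : HilbertLimit V) :
    Tendsto (fun n => stageProjection V n x) atTop (𝓝 x) := by
  rw [Metric.tendsto_atTop]
  intro ε hε
  obtain ⟨_, ⟨n, -, y, rfl⟩, hy⟩ := (dense_toHilbertLimit V 0).exists_dist_lt x (half_pos hε)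
  refine ⟨n, fun k hk => ?_⟩
  set z := toHilbertLimit V n y
  calc dist (stageProjection V k x) x
      ≤ dist (stageProjection V k x) (stageProjection V k z) + dist z x := by
        rw [stageProjection_toHilbertLimit V hk]
        exact dist_triangle _ _ _
    _ ≤ dist x z + dist z x := by
        gcongr
        simpa [dist_eq_norm] using
          (stageProjection V k).le_of_opNorm_le (norm_stageProjection_le V k) (x - z)
    _ < ε := by
        rw [dist_comm z x]
        linarith

end Projection

end HilbertLimit

/-! ### The universal property of inductive limits of `C*`-algebras -/

section CStarLimit

open CStarLimit

variable {B : ℕ → Type*} [∀ n, NonUnitalCStarAlgebra (B n)] {φ : ∀ n, B n →⋆ₙₐ[ℂ] B (n + 1)}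
  {A : Type*} [NonUnitalCStarAlgebra A] (ρ : ∀ n, B n →⋆ₙₐ[ℂ] A)
  (hρ : ∀ n b, ρ (n + 1) (φ n b) = ρ n b)

section

variable {ρ}

include hρ

theorem apply_homTo_of_compatible {n k : ℕ} (h : n ≤ k) (b : B n) : ρ k (homTo φ h b) = ρ n b := by
  induction k, h using Nat.le_induction with
  | base => rw [homTo_self]
  | succ k hk ih => rw [homTo_succ φ hk, hρ, ih]

theorem AsymptoticSeq.cauchySeq_apply (f : AsymptoticSeq φ) : CauchySeq fun n => ρ n (seq f n) := by
  rw [Metric.cauchySeq_iff']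
  intro ε hε
  obtain ⟨N, hN⟩ := isAsymptotic_seq f (ε / 2) (half_pos hε)
  refine ⟨N, fun n hn => ?_⟩
  calc dist (ρ n (seq f n)) (ρ N (seq f N))
      = ‖ρ n (seq f n - homTo φ hn (seq f N))‖ := by
        rw [dist_eq_norm, map_sub, apply_homTo_of_compatible hρ]
    _ ≤ ε / 2 := (NonUnitalStarAlgHom.norm_apply_le _ _).trans (hN N le_rfl n hn)
    _ < ε := half_lt_self hε

theorem AsymptoticSeq.tendsto_apply (f : AsymptoticSeq φ) :
    Tendsto (fun n => ρ n (seq f n)) atTop (𝓝 (limUnder atTop fun n => ρ n (seq f n))) :=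
  (cauchySeq_apply hρ f).tendsto_limUnder

theorem AsymptoticSeq.limUnder_apply_eq_of_inseparable {f g : AsymptoticSeq φ}
    (h : Inseparable f g) :
    (limUnder atTop fun n => ρ n (seq f n)) = limUnder atTop fun n => ρ n (seq g n) := by
  have hfg : Tendsto (fun n => ‖seq f n - seq g n‖) atTop (𝓝 0) := by
    rw [Metric.inseparable_iff, dist_eq_norm] at h
    exact h ▸ tendsto_norm (f - g)
  refine (((tendsto_apply hρ f).congr_dist ?_).limUnder_eq).symm
  refine squeeze_zero (fun _ => dist_nonneg) (fun n => ?_) hfg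
  rw [dist_eq_norm, ← map_sub]
  exact NonUnitalStarAlgHom.norm_apply_le _ _

end

/-- The `*`-homomorphism `lim (B_n, φ_n) → A` induced by compatible `*`-homomorphisms
`ρ_n : B_n → A`; it sends the class of a sequence `f` to `lim ρ_n(f_n)`. -/
def CStarLimit.lift : CStarLimit φ →⋆ₙₐ[ℂ] A :=
  let q : CStarLimit φ → A :=
    SeparationQuotient.lift (fun f => limUnder atTop fun n => ρ n (AsymptoticSeq.seq f n))
      fun _ _ => AsymptoticSeq.limUnder_apply_eq_of_inseparable hρ
  have eq_of_tendsto (f : AsymptoticSeq φ) {a : A}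
      (ha : Tendsto (fun n => ρ n (AsymptoticSeq.seq f n)) atTop (𝓝 a)) : q (mk f) = a :=
    ha.limUnder_eq
  have tendsto := AsymptoticSeq.tendsto_apply hρ
  { toFun := q
    map_smul' c x := by
      obtain ⟨f, rfl⟩ := mk_surjective x
      exact eq_of_tendsto (c • f) <|
        ((tendsto f).const_smul c).congr fun n => (map_smul (ρ n) c _).symm
    map_zero' := eq_of_tendsto 0 <| tendsto_const_nhds.congr fun n => (map_zero (ρ n)).symm
    map_add' x y := by
      obtain ⟨f, rfl⟩ := mk_surjective x
      obtain ⟨g, rfl⟩ := mk_surjective y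
      exact eq_of_tendsto (f + g) <|
        ((tendsto f).add (tendsto g)).congr fun n => (map_add (ρ n) _ _).symm
    map_mul' x y := by
      obtain ⟨f, rfl⟩ := mk_surjective x
      obtain ⟨g, rfl⟩ := mk_surjective y
      exact eq_of_tendsto (f * g) <|
        ((tendsto f).mul (tendsto g)).congr fun n => (map_mul (ρ n) _ _).symm
    map_star' x := by
      obtain ⟨f, rfl⟩ := mk_surjective x
      exact eq_of_tendsto (star f) <| (tendsto f).star.congr fun n => (map_star (ρ n) _).symm }

theorem CStarLimit.tendsto_lift_mk (f : AsymptoticSeq φ) :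
    Tendsto (fun n => ρ n (AsymptoticSeq.seq f n)) atTop (𝓝 (lift ρ hρ (mk f))) :=
  AsymptoticSeq.tendsto_apply hρ f

theorem CStarLimit.lift_of (n : ℕ) (b : B n) : lift ρ hρ (of φ n b) = ρ n b := by
  refine tendsto_nhds_unique (tendsto_lift_mk ρ hρ _) (tendsto_const_nhds.congr' ?_)
  filter_upwards [eventually_ge_atTop n] with k hk
  change ρ n b = ρ k (if h : n ≤ k then homTo φ h b else 0)
  rw [dif_pos hk, apply_homTo_of_compatible hρ]

theorem CStarLimit.lift_injective (hinj : ∀ n, Function.Injective (ρ n)) :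
    Function.Injective (lift ρ hρ) := by
  rw [injective_iff_map_eq_zero]
  intro x hx
  obtain ⟨f, rfl⟩ := mk_surjective x
  have hf := (tendsto_lift_mk ρ hρ f).norm.congr fun n =>
    NonUnitalStarAlgHom.norm_map (ρ n) (hinj n) _
  rw [← norm_eq_zero, norm_mk, tendsto_nhds_unique (AsymptoticSeq.tendsto_norm f) hf, hx, norm_zero]

end CStarLimit

/-! ### Faithfulness of the traces -/

section FaithfulTrace

variable {m : ℕ} (Θ : Matrix (Fin m) (Fin m) ℝ)

theorem cocycle_add_left (x y z : Fin m → ℤ) :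
    cocycle Θ (x + y) z = cocycle Θ x z * cocycle Θ y z := by
  simp only [cocycle, Pi.add_apply, Int.cast_add, mul_add, add_mul, ite_add_zero,
    Finset.sum_add_distrib, Complex.ofReal_add, Complex.exp_add]

theorem cocycle_add_right (x y z : Fin m → ℤ) :
    cocycle Θ x (y + z) = cocycle Θ x y * cocycle Θ x z := by
  simp only [cocycle, Pi.add_apply, Int.cast_add, mul_add, add_mul, ite_add_zero,
    Finset.sum_add_distrib, Complex.ofReal_add, Complex.exp_add]

theorem cocycle_zero_left (x : Fin m → ℤ) : cocycle Θ 0 x = 1 := by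
  simp [cocycle]

/-- The twisted right translation `δ_y ↦ ω_Θ(y, x) δ_{y+x}` on `ℓ²(ℤᵐ)`. -/
def rightTranslation (x : Fin m → ℤ) : L2Z m →ₗᵢ[ℂ] L2Z m where
  toFun f := ⟨fun y => cocycle Θ (y - x) x * f (y - x),
    memℓp_gen ((hasSum_translation Θ x f).summable.congr fun y => by simp [norm_cocycle])⟩
  map_add' f g := by
    ext y
    exact mul_add _ _ _
  map_smul' c f := by
    ext y
    exact mul_left_comm _ _ _
  norm_map' f := by
    have htwo : (0 : ℝ) < (2 : ENNReal).toReal := by norm_num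
    rw [← (translation Θ x).norm_map f, lp.norm_eq_tsum_rpow htwo, lp.norm_eq_tsum_rpow htwo]
    congr 2
    ext y
    simp [translation_apply, norm_cocycle]

theorem rightTranslation_apply (x : Fin m → ℤ) (f : L2Z m) (y : Fin m → ℤ) :
    rightTranslation Θ x f y = cocycle Θ (y - x) x * f (y - x) :=
  rfl

theorem rightTranslation_single_zero (x : Fin m → ℤ) :
    rightTranslation Θ x (lp.single 2 0 1) = lp.single 2 x 1 := by
  ext y
  rw [rightTranslation_apply]
  obtain rfl | hyx := eq_or_ne y x
  · simp [cocycle_zero_left]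
  · simp [hyx, sub_ne_zero.2 hyx]

theorem commute_rightTranslation_translation (x y : Fin m → ℤ) :
    Commute (rightTranslation Θ x).toContinuousLinearMap
      (translation Θ y).toContinuousLinearMap := by
  ext f z
  change cocycle Θ (z - x) x * (cocycle Θ y (z - x - y) * f (z - x - y)) =
    cocycle Θ y (z - y) * (cocycle Θ (z - y - x) x * f (z - y - x))
  have hleft : cocycle Θ (z - x) x = cocycle Θ (z - x - y) x * cocycle Θ y x := by
    rw [← cocycle_add_left, sub_add_cancel]
  have hright : cocycle Θ y (z - y) = cocycle Θ y (z - x - y) * cocycle Θ y x := by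
    rw [← cocycle_add_right, sub_right_comm, sub_add_cancel]
  rw [hleft, hright, sub_right_comm z y x]
  ring

theorem translation_zero : (translation Θ 0).toContinuousLinearMap = 1 := by
  ext f y
  simp [translation_apply, cocycle_zero_left]

theorem star_translation (x : Fin m → ℤ) :
    star (translation Θ x).toContinuousLinearMap =
      (cocycle Θ x (-x))⁻¹ • (translation Θ (-x)).toContinuousLinearMap := by
  refine left_inv_eq_right_inv (a := (translation Θ x).toContinuousLinearMap)
    (translation Θ x).adjoint_comp_self ?_
  have hcocycle : cocycle Θ x (-x) ≠ 0 := Complex.exp_ne_zero _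
  rw [mul_smul_comm, inv_smul_eq_iff₀ hcocycle, ← translation_zero Θ, ← add_neg_cancel x]
  ext1 f
  exact translation_mul Θ x (-x) f

variable {Θ}

namespace NCTorus

theorem toCLM_rightTranslation (a : NCTorus Θ) (x : Fin m → ℤ) (f : L2Z m) :
    toCLM a (rightTranslation Θ x f) = rightTranslation Θ x (toCLM a f) := by
  have hcentralizer : (rightTranslation Θ x).toContinuousLinearMap ∈ StarSubalgebra.centralizer ℂ
      (Set.range fun y : Fin m → ℤ => (translation Θ y).toContinuousLinearMap) := by
    rw [StarSubalgebra.mem_centralizer_iff]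
    rintro _ ⟨y, rfl⟩
    refine ⟨(commute_rightTranslation_translation Θ x y).symm.eq, ?_⟩
    rw [star_translation]
    exact ((commute_rightTranslation_translation Θ x (-y)).smul_right _).symm.eq
  have hcomm := (StarSubalgebra.mem_centralizer_iff ℂ).1
    (StarSubalgebra.topologicalClosure_adjoin_le_centralizer_centralizer ℂ _ a.2) _ hcentralizer
  exact (DFunLike.congr_fun hcomm.1 f).symm

theorem trace_star_mul_self (a : NCTorus Θ) :
    trace (star a * a) = ⟪toCLM a (lp.single 2 0 1), toCLM a (lp.single 2 0 1)⟫_ℂ := by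
  rw [← ContinuousLinearMap.adjoint_inner_right, ← ContinuousLinearMap.star_eq_adjoint,
    lp.inner_single_left]
  simp [trace, coeff, ← map_star]

theorem eq_zero_of_trace_star_mul_self {a : NCTorus Θ} (h : trace (star a * a) = 0) : a = 0 := by
  rw [trace_star_mul_self, inner_self_eq_zero] at h
  refine Subtype.ext (lp.ext_continuousLinearMap (by norm_num) fun x => ?_)
  ext1
  change toCLM a (lp.single 2 x 1) = 0
  rw [← rightTranslation_single_zero Θ, toCLM_rightTranslation, h, map_zero]

end NCTorus

namespace MatTorus

variable {r : ℕ}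

theorem trace_star_mul_self (b : MatTorus r Θ) : trace (star b * b) =
    (r : ℂ)⁻¹ * ∑ i, ∑ k, NCTorus.trace (star (b.entry k i) * b.entry k i) := by
  change (r : ℂ)⁻¹ * ∑ i, NCTorus.trace (∑ k, star (b.entry k i) * b.entry k i) = _
  simp only [map_sum]

theorem eq_zero_of_trace_star_mul_self {b : MatTorus r Θ} (h : trace (star b * b) = 0) :
    b = 0 := by
  refine CStarMatrix.ext fun k i => NCTorus.eq_zero_of_trace_star_mul_self ?_
  have hr : (r : ℂ) ≠ 0 := Nat.cast_ne_zero.2 (Fin.pos i).ne'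
  have hnonneg (i k : Fin r) : 0 ≤ NCTorus.trace (star (b.entry k i) * b.entry k i) :=
    NCTorus.trace_star_mul_self_nonneg _
  have hsum := (mul_eq_zero.1 ((trace_star_mul_self b).symm.trans h)).resolve_left (inv_ne_zero hr)
  have hcolumn := (Finset.sum_eq_zero_iff_of_nonneg fun i _ =>
    Finset.sum_nonneg fun k _ => hnonneg i k).1 hsum i (Finset.mem_univ i)
  exact (Finset.sum_eq_zero_iff_of_nonneg fun k _ => hnonneg i k).1 hcolumn k (Finset.mem_univ k)

end MatTorus

end FaithfulTrace

/-! ### Left multiplication on `L²(A, τ) ⊗ S` -/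

namespace L2Tensor

section NonUnital

variable {A : Type*} [NonUnitalCStarAlgebra A] [PartialOrder A] [StarOrderedRing A]
  (τ : A →ₚ[ℂ] ℂ) {S : Type*} [NormedAddCommGroup S] [InnerProductSpace ℂ S]

theorem denseRange_ofTensor : DenseRange (ofTensor τ (S := S)) :=
  UniformSpace.Completion.denseRange_coe

theorem clm_ext {G : Type*} [NormedAddCommGroup G] [NormedSpace ℂ G] {T T' : L2Tensor τ S →L[ℂ] G}
    (h : ∀ x, T (ofTensor τ x) = T' (ofTensor τ x)) : T = T' :=
  ContinuousLinearMap.coeFn_injective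
    ((denseRange_ofTensor τ).equalizer T.continuous T'.continuous (funext h))

theorem inner_rTensor (a : A) (x y : τ.GNS ⊗[ℂ] S) :
    ⟪(τ.gnsNonUnitalStarAlgHom (star a) : τ.GNS →ₗ[ℂ] τ.GNS).rTensor S x, y⟫_ℂ =
      ⟪x, (τ.gnsNonUnitalStarAlgHom a : τ.GNS →ₗ[ℂ] τ.GNS).rTensor S y⟫_ℂ := by
  induction x with
  | zero => simp
  | add x x' hx hx' => rw [map_add, inner_add_left, inner_add_left, hx, hx']
  | tmul u s =>
    induction y with
    | zero => simp
    | add y y' hy hy' => rw [map_add, inner_add_right, inner_add_right, hy, hy']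
    | tmul v t =>
      rw [LinearMap.rTensor_tmul, LinearMap.rTensor_tmul, TensorProduct.inner_tmul,
        TensorProduct.inner_tmul, map_star, ContinuousLinearMap.star_eq_adjoint,
        ContinuousLinearMap.coe_coe, ContinuousLinearMap.coe_coe,
        ContinuousLinearMap.adjoint_inner_left]

theorem norm_vec (a : A) (ξ : S) : ‖vec τ a ξ‖ = √(τ (star a * a)).re * ‖ξ‖ := by
  rw [vec, LinearIsometry.norm_map, TensorProduct.norm_tmul, UniformSpace.Completion.norm_coe,
    PositiveLinearMap.preGNS_norm_def]
  rfl

variable (S) [FiniteDimensional ℂ S]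

/-- The representation of `A` on `L²(A, τ) ⊗ S` by left multiplication. -/
def leftMulHom : A →⋆ₙₐ[ℂ] (L2Tensor τ S →L[ℂ] L2Tensor τ S) where
  toFun := leftMul τ
  map_smul' c a := clm_ext τ fun x => by
    rw [smul_apply, leftMul_ofTensor, leftMul_ofTensor, map_smul τ.gnsNonUnitalStarAlgHom]
    exact (congrArg (ofTensor τ) (DFunLike.congr_fun
      (LinearMap.rTensor_smul S c (τ.gnsNonUnitalStarAlgHom a : τ.GNS →ₗ[ℂ] τ.GNS)) x)).trans
      (map_smul (ofTensor τ) c _)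
  map_zero' := clm_ext τ fun x => by
    rw [leftMul_ofTensor, map_zero]
    simp
  map_add' a b := clm_ext τ fun x => by
    rw [add_apply, leftMul_ofTensor, leftMul_ofTensor, leftMul_ofTensor,
      map_add τ.gnsNonUnitalStarAlgHom]
    exact (congrArg (ofTensor τ) (DFunLike.congr_fun
      (LinearMap.rTensor_add S (τ.gnsNonUnitalStarAlgHom a : τ.GNS →ₗ[ℂ] τ.GNS)
        (τ.gnsNonUnitalStarAlgHom b : τ.GNS →ₗ[ℂ] τ.GNS)) x)).trans (map_add (ofTensor τ) _ _)
  map_mul' a b := clm_ext τ fun x => by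
    rw [mul_apply_eq_comp, leftMul_ofTensor, leftMul_ofTensor, leftMul_ofTensor, map_mul]
    exact congrArg (ofTensor τ) (LinearMap.rTensor_comp_apply S
      (τ.gnsNonUnitalStarAlgHom a : τ.GNS →ₗ[ℂ] τ.GNS)
      (τ.gnsNonUnitalStarAlgHom b : τ.GNS →ₗ[ℂ] τ.GNS) x)
  map_star' a := by
    rw [ContinuousLinearMap.star_eq_adjoint, ContinuousLinearMap.eq_adjoint_iff]
    refine fun x y => (denseRange_ofTensor τ).induction_on₂
      (isClosed_eq (by fun_prop) (by fun_prop)) (fun x y => ?_) x y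
    rw [leftMul_ofTensor, leftMul_ofTensor, LinearIsometry.inner_map_map,
      LinearIsometry.inner_map_map, inner_rTensor]

end NonUnital

section Unital

variable {A : Type*} [CStarAlgebra A] [PartialOrder A] [StarOrderedRing A]
  (τ : A →ₚ[ℂ] ℂ) (S : Type*) [NormedAddCommGroup S] [InnerProductSpace ℂ S]
  [FiniteDimensional ℂ S]

theorem leftMulHom_one : leftMulHom τ S 1 = 1 :=
  clm_ext τ fun x => by
    have hgns : τ.gnsNonUnitalStarAlgHom 1 = 1 := map_one τ.gnsStarAlgHom
    refine (leftMul_ofTensor τ 1 x).trans ?_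
    rw [hgns]
    exact congrArg (ofTensor τ) (LinearMap.rTensor_id_apply _ _ x)

theorem leftMulHom_injective [Nontrivial S] (hτ : ∀ a, τ (star a * a) = 0 → a = 0) :
    Function.Injective (leftMulHom τ S) := by
  rw [injective_iff_map_eq_zero]
  intro a ha
  obtain ⟨ξ, hξ⟩ := exists_ne (0 : S)
  have hvec : vec τ a ξ = 0 := by
    have h := leftMul_vec τ a 1 ξ
    rw [mul_one] at h
    rw [← h]
    exact DFunLike.congr_fun ha _
  rw [← norm_eq_zero, norm_vec, mul_eq_zero, or_iff_left (norm_ne_zero_iff.2 hξ)] at hvec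
  obtain ⟨hre, him⟩ := Complex.le_def.1 (τ.map_nonneg (star_mul_self_nonneg a))
  exact hτ a (Complex.ext ((Real.sqrt_eq_zero hre).1 hvec) him.symm)

end Unital

end L2Tensor

/-! ### Graphs of selfadjoint operators -/

section SubmoduleGraph

variable {H : Type*} [NormedAddCommGroup H] [InnerProductSpace ℂ H] {G : Submodule ℂ (H × H)}

variable (G) in
theorem isClosed_adjoint : IsClosed (G.adjoint : Set (H × H)) := by
  rw [Submodule.adjoint, Submodule.map_coe, LinearEquiv.coe_coe,
    LinearEquiv.image_eq_preimage_symm]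
  exact (Submodule.isClosed_orthogonal _).preimage (WithLp.prod_continuous_toLp _ _ _)

variable (G) in
theorem adjoint_topologicalClosure : G.topologicalClosure.adjoint = G.adjoint := by
  ext q
  simp only [Submodule.mem_adjoint_iff]
  refine ⟨fun h x y hxy => h x y (G.le_topologicalClosure hxy), fun h x y hxy => ?_⟩
  exact closure_minimal (t := {p : H × H | ⟪p.2, q.1⟫_ℂ - ⟪p.1, q.2⟫_ℂ = 0})
    (fun p hp => h p.1 p.2 hp) (isClosed_eq (by fun_prop) continuous_const) hxy

theorem graph_closure_toLinearPMap (hdense : Dense (G.map (LinearMap.fst ℂ H H) : Set H))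
    (hsymm : G ≤ G.adjoint) : G.toLinearPMap.closure.graph = G.topologicalClosure := by
  have snd_eq_zero : ∀ q ∈ G.topologicalClosure, q.1 = 0 → q.2 = 0 := by
    intro q hq hq₁
    have hadj : q ∈ G.adjoint := closure_minimal hsymm (isClosed_adjoint G) hq
    refine hdense.eq_zero_of_inner_right ℂ ?_
    rintro _ ⟨⟨x, y⟩, hxy, rfl⟩
    simpa [hq₁] using (Submodule.mem_adjoint_iff G q).1 hadj x y hxy
  have hgraph : G.toLinearPMap.graph = G :=
    G.toLinearPMap_graph_eq fun q hq => snd_eq_zero q (G.le_topologicalClosure hq)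
  have hclosable : G.toLinearPMap.IsClosable :=
    ⟨G.topologicalClosure.toLinearPMap, by
      rw [hgraph, Submodule.toLinearPMap_graph_eq _ snd_eq_zero]⟩
  rw [← hclosable.graph_closure_eq_closure_graph, hgraph]

theorem isSelfAdjoint_closure_toLinearPMap [CompleteSpace H]
    (hdense : Dense (G.map (LinearMap.fst ℂ H H) : Set H)) (hsymm : G ≤ G.adjoint)
    (hmax : G.adjoint ≤ G.topologicalClosure) : IsSelfAdjoint G.toLinearPMap.closure := by
  have hgraph := graph_closure_toLinearPMap hdense hsymm
  have hdomain : Dense (G.toLinearPMap.closure.domain : Set H) := by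
    rw [← LinearPMap.graph_map_fst_eq_domain, hgraph]
    exact hdense.mono (Submodule.map_mono G.le_topologicalClosure)
  rw [LinearPMap.isSelfAdjoint_def]
  refine LinearPMap.eq_of_eq_graph ?_
  rw [LinearPMap.adjoint_graph_eq_graph_adjoint hdomain, hgraph, adjoint_topologicalClosure]
  exact le_antisymm hmax (closure_minimal hsymm (isClosed_adjoint G))

theorem adjoint_graph_of_isSelfAdjoint [CompleteSpace H] {D : H →ₗ.[ℂ] H}
    (hD : IsSelfAdjoint D) : D.graph.adjoint = D.graph := by
  rw [← LinearPMap.adjoint_graph_eq_graph_adjoint hD.dense_domain,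
    LinearPMap.isSelfAdjoint_def.1 hD]

end SubmoduleGraph

/-! ### Intertwining isometries and commutators -/

section Intertwines

variable {E F : Type*} [NormedAddCommGroup E] [InnerProductSpace ℂ E]
  [NormedAddCommGroup F] [InnerProductSpace ℂ F]
  {V : E →ₗᵢ[ℂ] F} {D : E →ₗ.[ℂ] E} {D' : F →ₗ.[ℂ] F}

theorem mem_graph_iff_exists_mem_domain {x y : E} :
    (x, y) ∈ D.graph ↔ ∃ h : x ∈ D.domain, D ⟨x, h⟩ = y := by
  simp

theorem intertwines_iff_forall_mem_graph :
    Intertwines V D D' ↔ ∀ x y, (x, y) ∈ D.graph → (V x, V y) ∈ D'.graph := by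
  simp only [Intertwines, mem_graph_iff_exists_mem_domain, Subtype.forall]
  exact ⟨fun h x y ⟨hx, hxy⟩ => hxy ▸ h x hx, fun h x hx => h x _ ⟨hx, rfl⟩⟩

theorem commutatorExtendsTo_iff_forall_mem_graph {a T : E →L[ℂ] E} :
    CommutatorExtendsTo D a T ↔ ∀ x y, (x, y) ∈ D.graph → (a x, a y + T x) ∈ D.graph := by
  simp only [CommutatorExtendsTo, mem_graph_iff_exists_mem_domain, Subtype.forall,
    sub_eq_iff_eq_add']
  exact ⟨fun h x y ⟨hx, hxy⟩ => hxy ▸ h x hx, fun h x hx => h x _ ⟨hx, rfl⟩⟩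

theorem Intertwines.map_mem_graph (hV : Intertwines V D D') {x y : E} (h : (x, y) ∈ D.graph) :
    (V x, V y) ∈ D'.graph :=
  intertwines_iff_forall_mem_graph.1 hV x y h

theorem CommutatorExtendsTo.map_mem_graph {a T : E →L[ℂ] E} (hT : CommutatorExtendsTo D a T)
    {x y : E} (h : (x, y) ∈ D.graph) : (a x, a y + T x) ∈ D.graph :=
  commutatorExtendsTo_iff_forall_mem_graph.1 hT x y h

theorem Intertwines.comp {G : Type*} [NormedAddCommGroup G] [InnerProductSpace ℂ G]
    {W : F →ₗᵢ[ℂ] G} {D'' : G →ₗ.[ℂ] G} (hW : Intertwines W D' D'') (hV : Intertwines V D D') :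
    Intertwines (W.comp V) D D'' :=
  intertwines_iff_forall_mem_graph.2 fun _ _ h => hW.map_mem_graph (hV.map_mem_graph h)

theorem CommutatorExtendsTo.apply_intertwiner (hV : Intertwines V D D')
    (hD : Dense (D.domain : Set E)) {a T : E →L[ℂ] E} {a' T' : F →L[ℂ] F}
    (ha : ∀ x, a' (V x) = V (a x)) (hT : CommutatorExtendsTo D a T)
    (hT' : CommutatorExtendsTo D' a' T') (x : E) : T' (V x) = V (T x) := by
  refine congrFun (Continuous.ext_on hD (T'.continuous.comp V.continuous)
    (V.continuous.comp T.continuous) fun u hu => ?_) x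
  have hgraph := D.mem_graph ⟨u, hu⟩
  have heq := D'.mem_graph_snd_inj (hT'.map_mem_graph (hV.map_mem_graph hgraph))
    (hV.map_mem_graph (hT.map_mem_graph hgraph)) (ha u)
  rw [map_add, ha] at heq
  exact add_left_cancel heq

variable [CompleteSpace E] [CompleteSpace F]

theorem Intertwines.adjoint_mem_graph_of_mem_adjoint (hV : Intertwines V D D')
    (hD : IsSelfAdjoint D) {y w : F} (h : (y, w) ∈ D'.graph.adjoint) :
    (V.toContinuousLinearMap.adjoint y, V.toContinuousLinearMap.adjoint w) ∈ D.graph := by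
  rw [← adjoint_graph_of_isSelfAdjoint hD, Submodule.mem_adjoint_iff]
  intro x z hxz
  rw [ContinuousLinearMap.adjoint_inner_right, ContinuousLinearMap.adjoint_inner_right]
  exact (Submodule.mem_adjoint_iff _ _).1 h _ _ (hV.map_mem_graph hxz)

theorem CommutatorExtendsTo.compression (hV : Intertwines V D D') (hD : IsSelfAdjoint D)
    (hD' : IsSelfAdjoint D') {a : E →L[ℂ] E} {a' T : F →L[ℂ] F}
    (ha : ∀ x, a' (V x) = V (a x)) (hT : CommutatorExtendsTo D' a' T) :
    CommutatorExtendsTo D a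
      (V.toContinuousLinearMap.adjoint ∘L T ∘L V.toContinuousLinearMap) := by
  rw [commutatorExtendsTo_iff_forall_mem_graph]
  intro x y hxy
  have h := hT.map_mem_graph (hV.map_mem_graph hxy)
  rw [← adjoint_graph_of_isSelfAdjoint hD', ha, ha] at h
  simpa only [map_add, adjoint_apply_map, ContinuousLinearMap.comp_apply,
    LinearIsometry.coe_toContinuousLinearMap] using hV.adjoint_mem_graph_of_mem_adjoint hD h

theorem norm_compression_le (V : E →ₗᵢ[ℂ] F) (T : F →L[ℂ] F) :
    ‖V.toContinuousLinearMap.adjoint ∘L T ∘L V.toContinuousLinearMap‖ ≤ ‖T‖ :=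
  calc
    _ ≤ ‖V.toContinuousLinearMap.adjoint‖ * (‖T‖ * ‖V.toContinuousLinearMap‖) :=
      (ContinuousLinearMap.opNorm_comp_le _ _).trans <|
        mul_le_mul_of_nonneg_left (ContinuousLinearMap.opNorm_comp_le _ _) (norm_nonneg _)
    _ ≤ 1 * (‖T‖ * 1) := by
      gcongr
      exacts [norm_adjoint_toContinuousLinearMap_le V, V.norm_toContinuousLinearMap_le]
    _ = ‖T‖ := by ring

end Intertwines

/-! ### Inductive limits of selfadjoint operators -/

section LimitOperator

variable {E : ℕ → Type*} [∀ n, NormedAddCommGroup (E n)] [∀ n, InnerProductSpace ℂ (E n)]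
  (V : ∀ n, E n →ₗᵢ[ℂ] E (n + 1)) (D : ∀ n, E n →ₗ.[ℂ] E n)

/-- The image in the limit of the graph of the `n`-th operator. -/
def stageGraph (n : ℕ) : Submodule ℂ (HilbertLimit V × HilbertLimit V) :=
  (D n).graph.map ((toHilbertLimit V n).toLinearMap.prodMap (toHilbertLimit V n).toLinearMap)

/-- The supremum of the images of the graphs of the operators `D_n`; if the isometries `V_n`
intertwine these operators, it is their union. -/
def limitGraph : Submodule ℂ (HilbertLimit V × HilbertLimit V) := ⨆ n, stageGraph V D n

/-- The closure of the operator on `⋃ V_{n,∞}(dom D_n)` that extends the images of all `D_n`. -/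
def limitOperator : HilbertLimit V →ₗ.[ℂ] HilbertLimit V := (limitGraph V D).toLinearPMap.closure

variable {V D}

theorem mem_stageGraph {n : ℕ} {q : HilbertLimit V × HilbertLimit V} :
    q ∈ stageGraph V D n ↔
      ∃ x y, (x, y) ∈ (D n).graph ∧ (toHilbertLimit V n x, toHilbertLimit V n y) = q :=
  Prod.exists

theorem map_mem_limitGraph {n : ℕ} {x y : E n} (h : (x, y) ∈ (D n).graph) :
    (toHilbertLimit V n x, toHilbertLimit V n y) ∈ limitGraph V D :=
  Submodule.mem_iSup_of_mem n (mem_stageGraph.2 ⟨x, y, h, rfl⟩)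

theorem dense_fst_limitGraph (hD : ∀ n, Dense ((D n).domain : Set (E n))) :
    Dense ((limitGraph V D).map (LinearMap.fst ℂ _ _) : Set (HilbertLimit V)) := by
  rw [← dense_closure]
  refine (dense_toHilbertLimit V 0).mono ?_
  rintro _ ⟨n, -, x, rfl⟩
  refine map_mem_closure (toHilbertLimit V n).continuous (hD n x) fun u hu => ?_
  exact ⟨_, map_mem_limitGraph ((D n).mem_graph ⟨u, hu⟩), rfl⟩

variable (hV : ∀ n, Intertwines (V n) (D n) (D (n + 1)))

include hV

theorem monotone_stageGraph : Monotone (stageGraph V D) := by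
  refine monotone_nat_of_le_succ fun n q hq => ?_
  obtain ⟨x, y, h, rfl⟩ := mem_stageGraph.1 hq
  refine mem_stageGraph.2 ⟨_, _, (hV n).map_mem_graph h, ?_⟩
  rw [toHilbertLimit_succ, toHilbertLimit_succ]

theorem exists_of_mem_limitGraph (n₀ : ℕ) {q : HilbertLimit V × HilbertLimit V}
    (hq : q ∈ limitGraph V D) : ∃ n ≥ n₀, ∃ x y, (x, y) ∈ (D n).graph ∧
      (toHilbertLimit V n x, toHilbertLimit V n y) = q := by
  have hmono := monotone_stageGraph hV
  obtain ⟨n, hn⟩ := (Submodule.mem_iSup_of_directed _ hmono.directed_le).1 hq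
  exact ⟨max n n₀, le_max_right _ _, mem_stageGraph.1 (hmono (le_max_left _ _) hn)⟩

variable [∀ n, CompleteSpace (E n)] (hD : ∀ n, IsSelfAdjoint (D n))

include hD

theorem limitGraph_le_adjoint : limitGraph V D ≤ (limitGraph V D).adjoint := by
  intro q hq
  rw [Submodule.mem_adjoint_iff]
  intro x y hxy
  obtain ⟨n, -, u, v, huv, rfl⟩ := exists_of_mem_limitGraph hV 0 hq
  obtain ⟨k, hk, u', v', huv', hxy'⟩ := exists_of_mem_limitGraph hV n hxy
  obtain ⟨rfl, rfl⟩ := Prod.mk.inj hxy'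
  obtain ⟨u'', v'', huv'', hq'⟩ := mem_stageGraph.1
    (monotone_stageGraph hV hk (mem_stageGraph.2 ⟨u, v, huv, rfl⟩))
  rw [← hq']
  rw [← adjoint_graph_of_isSelfAdjoint (hD k), Submodule.mem_adjoint_iff] at huv''
  simpa only [LinearIsometry.inner_map_map] using huv'' u' v' huv'

theorem graph_limitOperator :
    (limitOperator V D).graph = (limitGraph V D).topologicalClosure :=
  graph_closure_toLinearPMap (dense_fst_limitGraph fun n => (hD n).dense_domain)
    (limitGraph_le_adjoint hV hD)

theorem intertwines_limitOperator (n : ℕ) :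
    Intertwines (toHilbertLimit V n) (D n) (limitOperator V D) := by
  rw [intertwines_iff_forall_mem_graph, graph_limitOperator hV hD]
  exact fun x y hxy => Submodule.le_topologicalClosure _ (map_mem_limitGraph hxy)

theorem isSelfAdjoint_limitOperator : IsSelfAdjoint (limitOperator V D) := by
  refine isSelfAdjoint_closure_toLinearPMap
    (dense_fst_limitGraph fun n => (hD n).dense_domain) (limitGraph_le_adjoint hV hD) ?_
  rintro ⟨y, w⟩ hyw
  rw [← adjoint_topologicalClosure, ← graph_limitOperator hV hD] at hyw
  have hproj (n : ℕ) : (stageProjection V n y, stageProjection V n w) ∈ limitGraph V D :=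
    map_mem_limitGraph
      ((intertwines_limitOperator hV hD n).adjoint_mem_graph_of_mem_adjoint (hD n) hyw)
  exact mem_closure_of_tendsto
    ((tendsto_stageProjection V y).prodMk_nhds (tendsto_stageProjection V w))
    (Eventually.of_forall hproj)

variable {n₀ : ℕ} {a : HilbertLimit V →L[ℂ] HilbertLimit V} {a' : ∀ n, n₀ ≤ n → E n →L[ℂ] E n}
  (ha : ∀ n h x, a (toHilbertLimit V n x) = toHilbertLimit V n (a' n h x))

include ha

theorem commutatorExtendsTo_limitOperator {T : HilbertLimit V →L[ℂ] HilbertLimit V}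
    {T' : ∀ n, n₀ ≤ n → E n →L[ℂ] E n}
    (hT : ∀ n h x, T (toHilbertLimit V n x) = toHilbertLimit V n (T' n h x))
    (hcomm : ∀ n h, CommutatorExtendsTo (D n) (a' n h) (T' n h)) :
    CommutatorExtendsTo (limitOperator V D) a T := by
  rw [commutatorExtendsTo_iff_forall_mem_graph, graph_limitOperator hV hD]
  intro x y hxy
  refine map_mem_closure (f := fun q : HilbertLimit V × HilbertLimit V => (a q.1, a q.2 + T q.1))
    (by fun_prop) hxy fun q hq => ?_
  obtain ⟨n, hn, u, v, huv, rfl⟩ := exists_of_mem_limitGraph hV n₀ hq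
  change (a _, a _ + T _) ∈ limitGraph V D
  rw [ha n hn, ha n hn, hT n hn, ← map_add]
  exact map_mem_limitGraph ((hcomm n hn).map_mem_graph huv)

theorem exists_commutatorExtendsTo_limitOperator_iff :
    (∃ T, CommutatorExtendsTo (limitOperator V D) a T) ↔
      ∃ C : ℝ, ∀ n h, ∃ T, CommutatorExtendsTo (D n) (a' n h) T ∧ ‖T‖ ≤ C := by
  constructor
  · rintro ⟨T, hT⟩
    exact ⟨‖T‖, fun n h => ⟨_, hT.compression (intertwines_limitOperator hV hD n) (hD n)
      (isSelfAdjoint_limitOperator hV hD) (ha n h), norm_compression_le _ T⟩⟩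
  · rintro ⟨C, hC⟩
    choose T hT hTC using hC
    have hVa (n : ℕ) (h : n₀ ≤ n) (x : E n) :
        a' (n + 1) (Nat.le_succ_of_le h) (V n x) = V n (a' n h x) :=
      (toHilbertLimit V (n + 1)).injective <| by
        rw [← ha, toHilbertLimit_succ, toHilbertLimit_succ, ha n h]
    have hVT (n : ℕ) (h : n₀ ≤ n) (x : E n) :
        T (n + 1) (Nat.le_succ_of_le h) (V n x) = V n (T n h x) :=
      (hT n h).apply_intertwiner (hV n) (hD n).dense_domain (hVa n h) (hT _ _) x
    exact ⟨limitMap T hVT, commutatorExtendsTo_limitOperator hV hD ha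
      (fun n h x => limitMap_toHilbertLimit T hVT hTC h x) hT⟩

end LimitOperator

/-! ### The limit representation -/

section LimitRepresentation

variable {B E : ℕ → Type*} [∀ n, NonUnitalCStarAlgebra (B n)] [∀ n, NormedAddCommGroup (E n)]
  [∀ n, InnerProductSpace ℂ (E n)] [∀ n, CompleteSpace (E n)]
  {φ : ∀ n, B n →⋆ₙₐ[ℂ] B (n + 1)} {V : ∀ n, E n →ₗᵢ[ℂ] E (n + 1)}
  (ρ : ∀ n, B n →⋆ₙₐ[ℂ] (E n →L[ℂ] E n))
  (hρ : ∀ n b x, V n (ρ n b x) = ρ (n + 1) (φ n b) (V n x))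

section

variable {ρ}

include hρ in
theorem apply_homTo_succ {n k : ℕ} (h : n ≤ k) (b : B n) (x : E k) :
    ρ (k + 1) (homTo φ (Nat.le_succ_of_le h) b) (V k x) = V k (ρ k (homTo φ h b) x) := by
  rw [hρ, homTo_succ φ h]

theorem limitMap_apply_homTo {n k : ℕ} (h : n ≤ k) (b : B n) (x : E k) :
    limitMap (fun _ h => ρ _ (homTo φ h b)) (fun _ h => apply_homTo_succ hρ h b)
        (toHilbertLimit V k x) = toHilbertLimit V k (ρ k (homTo φ h b) x) :=
  limitMap_toHilbertLimit _ _
    (fun k h => (NonUnitalStarAlgHom.norm_apply_le (ρ k) _).trans (norm_homTo_le h b)) h x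

end

/-- The representation of the `n`-th algebra on the limit Hilbert space that acts on the image of
each later stage `k` by `ρ_k ∘ φ_{n,k}`. -/
def stageRep (n : ℕ) : B n →⋆ₙₐ[ℂ] (HilbertLimit V →L[ℂ] HilbertLimit V) where
  toFun b := limitMap (fun _ h => ρ _ (homTo φ h b)) (fun _ h => apply_homTo_succ hρ h b)
  map_smul' c a := HilbertLimit.clm_ext n fun k hk x => by
    rw [smul_apply, limitMap_apply_homTo hρ hk, limitMap_apply_homTo hρ hk, map_smul, map_smul]
    exact (toHilbertLimit V k).map_smul c _
  map_zero' := HilbertLimit.clm_ext n fun k hk x => by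
    rw [limitMap_apply_homTo hρ hk, map_zero, map_zero]
    exact map_zero (toHilbertLimit V k)
  map_add' a b := HilbertLimit.clm_ext n fun k hk x => by
    rw [add_apply, limitMap_apply_homTo hρ hk, limitMap_apply_homTo hρ hk,
      limitMap_apply_homTo hρ hk, map_add, map_add]
    exact map_add (toHilbertLimit V k) _ _
  map_mul' a b := HilbertLimit.clm_ext n fun k hk x => by
    rw [mul_apply_eq_comp, limitMap_apply_homTo hρ hk, limitMap_apply_homTo hρ hk,
      limitMap_apply_homTo hρ hk, map_mul, map_mul]
    rfl
  map_star' a := by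
    rw [ContinuousLinearMap.star_eq_adjoint, ContinuousLinearMap.eq_adjoint_iff]
    refine HilbertLimit.induction_pair n (isClosed_eq (by fun_prop) (by fun_prop))
      fun k hk x y => ?_
    rw [limitMap_apply_homTo hρ hk, limitMap_apply_homTo hρ hk, LinearIsometry.inner_map_map,
      LinearIsometry.inner_map_map, map_star, map_star, ContinuousLinearMap.star_eq_adjoint,
      ContinuousLinearMap.adjoint_inner_left]

theorem stageRep_toHilbertLimit {n k : ℕ} (h : n ≤ k) (b : B n) (x : E k) :
    stageRep ρ hρ n b (toHilbertLimit V k x) = toHilbertLimit V k (ρ k (homTo φ h b) x) :=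
  limitMap_apply_homTo hρ h b x

theorem stageRep_succ (n : ℕ) (b : B n) : stageRep ρ hρ (n + 1) (φ n b) = stageRep ρ hρ n b := by
  refine HilbertLimit.clm_ext (n + 1) fun k hk x => ?_
  rw [stageRep_toHilbertLimit ρ hρ hk, stageRep_toHilbertLimit ρ hρ (n.le_succ.trans hk),
    ← homTo_trans φ n.le_succ hk, homTo_succ φ le_rfl, homTo_self]

theorem stageRep_injective {n : ℕ} (hinj : Function.Injective (ρ n)) :
    Function.Injective (stageRep ρ hρ n) := by
  intro a b hab
  refine hinj (ContinuousLinearMap.ext fun x => (toHilbertLimit V n).injective ?_)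
  simpa only [stageRep_toHilbertLimit ρ hρ le_rfl, homTo_self] using
    DFunLike.congr_fun hab (toHilbertLimit V n x)

/-- The representation of a `C*`-inductive limit on a Hilbert space inductive limit induced by
compatible representations `ρ_n` of the stages. -/
def limitRep : CStarLimit φ →⋆ₙₐ[ℂ] (HilbertLimit V →L[ℂ] HilbertLimit V) :=
  CStarLimit.lift (stageRep ρ hρ) (stageRep_succ ρ hρ)

theorem limitRep_of_toHilbertLimit {n k : ℕ} (h : n ≤ k) (b : B n) (x : E k) :
    limitRep ρ hρ (CStarLimit.of φ n b) (toHilbertLimit V k x) =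
      toHilbertLimit V k (ρ k (homTo φ h b) x) := by
  rw [limitRep, CStarLimit.lift_of, stageRep_toHilbertLimit ρ hρ h]

theorem limitRep_injective (hinj : ∀ n, Function.Injective (ρ n)) :
    Function.Injective (limitRep ρ hρ) :=
  CStarLimit.lift_injective _ _ fun n => stageRep_injective ρ hρ (hinj n)

theorem isNondegenerateRep_limitRep (hnd : ∀ n, IsNondegenerateRep (ρ n)) :
    IsNondegenerateRep (limitRep ρ hρ) := by
  refine dense_closure.1 ((dense_toHilbertLimit V 0).mono ?_)
  rintro _ ⟨n, -, x, rfl⟩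
  refine map_mem_closure (toHilbertLimit V n).continuous (hnd n x) fun u hu => ?_
  change u ∈ Submodule.comap (toHilbertLimit V n).toLinearMap (Submodule.span ℂ _)
  revert u
  refine Submodule.span_le.2 ?_
  rintro _ ⟨b, y, rfl⟩
  refine Submodule.subset_span ⟨CStarLimit.of φ n b, toHilbertLimit V n y, ?_⟩
  rw [limitRep_of_toHilbertLimit ρ hρ le_rfl, homTo_self]
  rfl

end LimitRepresentation

section LimitCommutators

variable {B E : ℕ → Type*} [∀ n, NonUnitalCStarAlgebra (B n)] [∀ n, NormedAddCommGroup (E n)]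
  [∀ n, InnerProductSpace ℂ (E n)] [∀ n, CompleteSpace (E n)]
  {φ : ∀ n, B n →⋆ₙₐ[ℂ] B (n + 1)} {V : ∀ n, E n →ₗᵢ[ℂ] E (n + 1)}
  (ρ : ∀ n, B n →⋆ₙₐ[ℂ] (E n →L[ℂ] E n)) (D : ∀ n, E n →ₗ.[ℂ] E n)

variable (φ) in
/-- The commutators of the operators `D_m`, `m ≥ n`, with the images of `a ∈ B_n` in the later
stages extend to bounded operators with uniformly bounded norms. -/
def HasBoundedStageCommutators {n : ℕ} (a : B n) : Prop :=
  ∃ C : ℝ, ∀ (m : ℕ) (h : n ≤ m), ∃ T : E m →L[ℂ] E m,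
    CommutatorExtendsTo (D m) (ρ m (homTo φ h a)) T ∧ ‖T‖ ≤ C

variable {ρ D}
  (hρ : ∀ n b x, V n (ρ n b x) = ρ (n + 1) (φ n b) (V n x))
  (hV : ∀ n, Intertwines (V n) (D n) (D (n + 1)))
  (hD : ∀ n, IsSelfAdjoint (D n))

include hV hD

theorem exists_commutatorExtendsTo_limitRep_iff {n : ℕ} (a : B n) :
    (∃ T, CommutatorExtendsTo (limitOperator V D) (limitRep ρ hρ (CStarLimit.of φ n a)) T) ↔
      HasBoundedStageCommutators φ ρ D a :=
  exists_commutatorExtendsTo_limitOperator_iff hV hD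
    fun _ h x => limitRep_of_toHilbertLimit ρ hρ h a x

theorem CommutatorExtendsTo.limitRep_apply {n m : ℕ} {a : B n}
    {T : HilbertLimit V →L[ℂ] HilbertLimit V} {Tm : E m →L[ℂ] E m} (h : n ≤ m)
    (hT : CommutatorExtendsTo (limitOperator V D) (limitRep ρ hρ (CStarLimit.of φ n a)) T)
    (hTm : CommutatorExtendsTo (D m) (ρ m (homTo φ h a)) Tm) (x : E m) :
    T (toHilbertLimit V m x) = toHilbertLimit V m (Tm x) :=
  hTm.apply_intertwiner (intertwines_limitOperator hV hD m) (hD m).dense_domain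
    (limitRep_of_toHilbertLimit ρ hρ h a) hT x

end LimitCommutators

/-! ### Local compactness -/

theorem isLocallyCompactOn_iff {A H : Type*} {ι : Sort*} [NonUnitalCStarAlgebra A]
    [NormedAddCommGroup H] [InnerProductSpace ℂ H] [CompleteSpace H]
    {𝒜 : NonUnitalStarSubalgebra ℂ A} {e : ι → A} (he : ∀ i, e i ∈ 𝒜)
    (hsupp : ∀ a ∈ 𝒜, ∃ i, a * e i = a) (π : A →⋆ₙₐ[ℂ] (H →L[ℂ] H)) (D : H →ₗ.[ℂ] H) :
    IsLocallyCompactOn 𝒜 π D ↔ ∀ i, IsCompactOperator (π (e i) ∘L invSqrtOneAddSq D) := by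
  refine ⟨fun h i => h _ (he i), fun h a ha => ?_⟩
  obtain ⟨i, hi⟩ := hsupp a ha
  rw [← hi, map_mul]
  exact (h i).clm_comp (π a)

/-! ### Protoral systems -/

theorem isNondegenerateRep_of_map_one {A H : Type*} [CStarAlgebra A] [NormedAddCommGroup H]
    [InnerProductSpace ℂ H] [CompleteSpace H] {π : A →⋆ₙₐ[ℂ] (H →L[ℂ] H)} (hπ : π 1 = 1) :
    IsNondegenerateRep π := fun x =>
  subset_closure (Submodule.subset_span ⟨1, x, by rw [hπ]; rfl⟩)

theorem ProtoralSystem.IsFinitelySupported.exists_mul_e_eq {X : ProtoralSystem}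
    {𝒜 : NonUnitalStarSubalgebra ℂ X.Apro} (h : X.IsFinitelySupported 𝒜) :
    ∀ a ∈ 𝒜, ∃ n, a * X.e n = a := by
  intro a ha
  obtain ⟨n, hn⟩ := h.supported a ha
  have he : X.e n * X.e n = X.e n := by rw [ProtoralSystem.e, ← map_mul, mul_one]
  exact ⟨n, by rw [hn, mul_assoc, he]⟩

namespace MoritaDirac

variable {X : ProtoralSystem} (M : MoritaDirac X)

/-- The representation `π_n` of `B_n` on `H_n` by left multiplication, as a `*`-homomorphism. -/
abbrev repHom (n : ℕ) : X.B n →⋆ₙₐ[ℂ] (M.H n →L[ℂ] M.H n) := L2Tensor.leftMulHom (X.τ n) (M.S n)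

theorem I_repHom (n : ℕ) (b : X.B n) (x : M.H n) :
    M.I n (M.repHom n b x) = M.repHom (n + 1) (X.φ n b) (M.I n x) := by
  change M.Iι n (M.Iα n (M.Iψ n (L2Tensor.leftMul (X.τ n) b x))) = _
  rw [M.rep_ψ, M.rep_α, M.rep_ι, M.factor]
  rfl

theorem intertwines_I (n : ℕ) : Intertwines (M.I n) (M.D n) (M.D (n + 1)) :=
  (M.intertwines_ι n).comp ((M.intertwines_α n).comp (M.intertwines_ψ n))

theorem repHom_injective (n : ℕ) : Function.Injective (M.repHom n) :=
  have := M.nontrivial_S n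
  L2Tensor.leftMulHom_injective (X.τ n) (M.S n) fun _ => MatTorus.eq_zero_of_trace_star_mul_self

theorem isNondegenerateRep_repHom (n : ℕ) : IsNondegenerateRep (M.repHom n) :=
  isNondegenerateRep_of_map_one (L2Tensor.leftMulHom_one (X.τ n) (M.S n))

end MoritaDirac

end Protorus

end

open Protorus in
theorem mainTheorem12_general {B E : ℕ → Type*} [∀ n, NonUnitalCStarAlgebra (B n)]
    [∀ n, NormedAddCommGroup (E n)] [∀ n, InnerProductSpace ℂ (E n)] [∀ n, CompleteSpace (E n)]
    {φ : ∀ n, B n →⋆ₙₐ[ℂ] B (n + 1)} {V : ∀ n, E n →ₗᵢ[ℂ] E (n + 1)}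
    (ρ : ∀ n, B n →⋆ₙₐ[ℂ] (E n →L[ℂ] E n))
    (hρ : ∀ n b x, V n (ρ n b x) = ρ (n + 1) (φ n b) (V n x))
    (hinj : ∀ n, Function.Injective (ρ n)) (hnd : ∀ n, IsNondegenerateRep (ρ n))
    {D : ∀ n, E n →ₗ.[ℂ] E n} (hD : ∀ n, IsSelfAdjoint (D n))
    (hV : ∀ n, Intertwines (V n) (D n) (D (n + 1))) :
    ∃ π : CStarLimit φ →⋆ₙₐ[ℂ] (HilbertLimit V →L[ℂ] HilbertLimit V),
      (∀ (n m k : ℕ) (hn : n ≤ k) (hm : m ≤ k) (b : B n) (x : E m),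
        π (CStarLimit.of φ n b) (toHilbertLimit V m x) =
          toHilbertLimit V k (ρ k (homTo φ hn b) (isometryTo V hm x))) ∧
      Function.Injective π ∧ IsNondegenerateRep π ∧ IsSelfAdjoint (limitOperator V D) ∧
      (∀ (n : ℕ) (a : B n),
        ((∃ T, CommutatorExtendsTo (limitOperator V D) (π (CStarLimit.of φ n a)) T) ↔
          HasBoundedStageCommutators φ ρ D a) ∧
        ∀ T, CommutatorExtendsTo (limitOperator V D) (π (CStarLimit.of φ n a)) T →
          ∀ (m : ℕ) (h : n ≤ m) (Tm : E m →L[ℂ] E m),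
            CommutatorExtendsTo (D m) (ρ m (homTo φ h a)) Tm →
              ∀ x, T (toHilbertLimit V m x) = toHilbertLimit V m (Tm x)) ∧
      (∀ (𝒜 : NonUnitalStarSubalgebra ℂ (CStarLimit φ)) (e : ℕ → CStarLimit φ),
        (∀ i, e i ∈ 𝒜) → (∀ a ∈ 𝒜, ∃ i, a * e i = a) →
          (IsLocallyCompactOn 𝒜 π (limitOperator V D) ↔
            ∀ i, IsCompactOperator (π (e i) ∘L invSqrtOneAddSq (limitOperator V D)))) ∧
      (∀ (𝒜 : NonUnitalStarSubalgebra ℂ (CStarLimit φ)) (e : ℕ → CStarLimit φ),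
        Dense (𝒜 : Set (CStarLimit φ)) → (∀ i, e i ∈ 𝒜) → (∀ a ∈ 𝒜, ∃ i, a * e i = a) →
        (∀ a ∈ 𝒜, (∃ T, CommutatorExtendsTo (limitOperator V D) (π a) T) ∨
          ∃ (n : ℕ) (b : B n), a = CStarLimit.of φ n b ∧ HasBoundedStageCommutators φ ρ D b) →
        (∀ i, IsCompactOperator (π (e i) ∘L invSqrtOneAddSq (limitOperator V D))) →
        IsLocallyCompactSpectralTriple 𝒜 π (limitOperator V D)) := by
  have hinj' := limitRep_injective ρ hρ hinj
  have hnd' := isNondegenerateRep_limitRep ρ hρ hnd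
  have hsa := isSelfAdjoint_limitOperator hV hD
  refine ⟨limitRep ρ hρ, fun n m k hn hm b x => ?_, hinj', hnd', hsa,
    fun n a => ⟨exists_commutatorExtendsTo_limitRep_iff hρ hV hD a,
      fun T hT m h Tm hTm => hT.limitRep_apply hρ hV hD h hTm⟩,
    fun 𝒜 e he hsupp => isLocallyCompactOn_iff he hsupp _ _,
    fun 𝒜 e hdense he hsupp hcomm hcpt => ⟨hinj', hnd', hsa, hdense, fun a ha => ?_,
      (isLocallyCompactOn_iff he hsupp _ _).2 hcpt⟩⟩
  · rw [← toHilbertLimit_isometryTo V hm, limitRep_of_toHilbertLimit ρ hρ hn]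
  · obtain hT | ⟨n, b, rfl, hb⟩ := hcomm a ha
    · exact hT
    · exact (exists_commutatorExtendsTo_limitRep_iff hρ hV hD b).2 hb

open Protorus in
/-- Spectral triples on protori from Morita-compatible Dirac structures. The limit representation
`π` of `A_pro` on `H_pro` exists, is faithful and nondegenerate, and `D_pro` is selfadjoint.
(i) For smooth `a ∈ B_n`, the commutator `[D_pro, π(ι_n(a))]` extends boundedly iff the stagewise
commutators extend boundedly with uniformly bounded norms, and then the extension `T` satisfies
`T I_{m,∞} = I_{m,∞} T_m`. (ii) Local compactness on a dense finitely supported `*`-subalgebra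
containing the `e_n` is equivalent to compactness of all `π(e_n)(1 + D_pro²)^{-1/2}`.
(iii) Together these conditions give a locally compact spectral triple. -/
theorem mainTheorem12 (X : ProtoralSystem) (M : MoritaDirac X) :
    ∃ π : X.Apro →⋆ₙₐ[ℂ] (M.Hpro →L[ℂ] M.Hpro),
      M.IsLimitRep π ∧ Function.Injective π ∧ IsNondegenerateRep π ∧ IsSelfAdjoint M.Dpro ∧
      (∀ (n : ℕ) (a : X.B n), a.IsSmooth →
        ((∃ T, CommutatorExtendsTo M.Dpro (π (X.ι n a)) T) ↔ M.StagewiseBounded a) ∧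
        ∀ T, CommutatorExtendsTo M.Dpro (π (X.ι n a)) T →
          ∀ (m : ℕ) (h : n ≤ m) (Tm : M.H m →L[ℂ] M.H m),
            CommutatorExtendsTo (M.D m) (M.rep m (X.φTo h a)) Tm →
              ∀ η : M.H m, T (M.Iinf m η) = M.Iinf m (Tm η)) ∧
      (∀ 𝒜 : NonUnitalStarSubalgebra ℂ X.Apro, X.IsFinitelySupported 𝒜 →
        (IsLocallyCompactOn 𝒜 π M.Dpro ↔
          ∀ n, IsCompactOperator (π (X.e n) ∘L invSqrtOneAddSq M.Dpro))) ∧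
      (∀ 𝒜 : NonUnitalStarSubalgebra ℂ X.Apro, X.IsFinitelySupported 𝒜 →
        (∀ a ∈ 𝒜, (∃ T, CommutatorExtendsTo M.Dpro (π a) T) ∨
          ∃ (n : ℕ) (b : X.B n), b.IsSmooth ∧ a = X.ι n b ∧ M.StagewiseBounded b) →
        (∀ n, IsCompactOperator (π (X.e n) ∘L invSqrtOneAddSq M.Dpro)) →
        IsLocallyCompactSpectralTriple 𝒜 π M.Dpro) := by
  obtain ⟨π, hrep, hinj, hnd, hsa, hcomm, hloc, htriple⟩ := mainTheorem12_general M.repHom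
    M.I_repHom M.repHom_injective M.isNondegenerateRep_repHom M.selfAdjoint_D M.intertwines_I
  exact ⟨π, hrep, hinj, hnd, hsa, fun n a _ => hcomm n a,
    fun 𝒜 h => hloc 𝒜 X.e h.e_mem h.exists_mul_e_eq,
    fun 𝒜 h hc hcpt => htriple 𝒜 X.e h.dense h.e_mem h.exists_mul_e_eq
      (fun a ha => (hc a ha).imp_right fun ⟨n, b, _, hb⟩ => ⟨n, b, hb⟩) hcpt⟩
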